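/- Let $\mu_0,\mu_1$ be probability measures on $\mathbb{R}$ such that, for $i=0,1$, $\mu_i$ is supported on a compact interval $\Omega_i=[a_i,b_i]$ and has there a continuous density $u_i$ with respect to Lebesgue measure satisfying $0<\lambda\le u_i\le\Lambda<\infty$ on $\Omega_i$ for some constants $\lambda,\Lambda$. For $\varepsilon>0$, let $(f_\varepsilon,g_\varepsilon)$ be the potentials of quadratically regularized optimal transport, i.e. functions that are continuous on $\Omega_0$ and $\Omega_1$, respectively, and such that $\big(\tfrac12x^2-f_\varepsilon(x),\,\tfrac12y^2-g_\varepsilon(y)\big)$ attains $$\sup_{(f,g)\in L^2(\mu_0)\times L^2(\mu_1)}\int f\,d\mu_0+\int g\,d\mu_1-\frac1{2\varepsilon}\int\Big(f(x)+g(y)-\tfrac12(x-y)^2\Big)_+^2\,d(\mu_0\otimes\mu_1)(x,y).$$ Let $(f_0,g_0)$ be the Kantorovich potentials of unregularized optimal transport, i.e. functions continuous on $\Omega_0$ and $\Omega_1$, respectively, that attain $$\inf\Big\{\int f\,d\mu_0+\int g\,d\mu_1:\ f\in L^1(\mu_0),\ g\in L^1(\mu_1),\ f(x)+g(y)\ge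 xy\ \text{ for all }(x,y)\in\Omega_0\times\Omega_1\Big\}.$$ Let the potentials be normalized symmetrically: $$\int f_\varepsilon\,d\mu_0=\int g_\varepsilon\,d\mu_1,\qquad \int f_0\,d\mu_0=\int g_0\,d\mu_1.$$ Then there exist constants $C,\varepsilon_0>0$, depending only on the marginals $\mu_0,\mu_1$, such that for every $0<\varepsilon<\varepsilon_0$, $$\|f_\varepsilon-f_0\|_{C^{0,1/2}(\Omega_0)}\le C\,\varepsilon^{1/3},$$ where $\|h\|_{C^{0,1/2}(\Omega_0)}=\sup_{x\in\Omega_0}|h(x)|+\sup_{x,y\in\Omega_0,\,x\ne y}\frac{|h(x)-h(y)|}{|x-y|^{1/2}}$. -/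

import Mathlib

open MeasureTheory Set
open scoped ENNReal

/-- Standing assumption on one marginal: `μ` is a probability measure supported by the compact
interval `[a, b]`, with a density `u` there that is continuous and satisfies `0 < l ≤ u ≤ L`. -/
structure IsRegularMarginal (μ : Measure ℝ) (a b : ℝ) (u : ℝ → ℝ) (l L : ℝ) : Prop where
  isProbabilityMeasure : IsProbabilityMeasure μ
  continuousOn_density : ContinuousOn u (Icc a b)
  lower_pos : 0 < l
  lower_le : ∀ x ∈ Icc a b, l ≤ u x
  le_upper : ∀ x ∈ Icc a b, u x ≤ L
  eq_withDensity :
    μ = (volume.restrict (Icc a b)).withDensity (fun x => ENNReal.ofReal (u x))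

/-- The objective of the dual problem of quadratically regularized optimal transport with cost
`(x - y)² / 2`:
`∫ f dμ₀ + ∫ g dμ₁ - (1 / (2ε)) ∫ (f(x) + g(y) - (x - y)² / 2)₊² d(μ₀ ⊗ μ₁)(x, y)`. -/
noncomputable def qotDualObjective (μ₀ μ₁ : Measure ℝ) (ε : ℝ) (f g : ℝ → ℝ) : ℝ :=
  (∫ x, f x ∂μ₀) + (∫ y, g y ∂μ₁)
    - 1 / (2 * ε) *
      ∫ z : ℝ × ℝ, (max (f z.1 + g z.2 - (z.1 - z.2) ^ 2 / 2) 0) ^ 2 ∂(μ₀.prod μ₁)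

/-- `(f, g)` attains the supremum of the dual problem of quadratically regularized optimal
transport over `L²(μ₀) × L²(μ₁)`. -/
structure IsQOTDualSolution (μ₀ μ₁ : Measure ℝ) (ε : ℝ) (f g : ℝ → ℝ) : Prop where
  memLp_left : MemLp f 2 μ₀
  memLp_right : MemLp g 2 μ₁
  maximal : ∀ f' g' : ℝ → ℝ, MemLp f' 2 μ₀ → MemLp g' 2 μ₁ →
    qotDualObjective μ₀ μ₁ ε f' g' ≤ qotDualObjective μ₀ μ₁ ε f g

/-- `(f, g)` are the (reparametrized) potentials of quadratically regularized optimal transport: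
`(x² / 2 - f, y² / 2 - g)` solves the dual problem. Dual solutions are determined only almost
everywhere; the potentials are the versions that are continuous on the supports `Ω₀`, `Ω₁` of the
marginals. Values outside the supports play no role. -/
structure IsQOTPotential (μ₀ μ₁ : Measure ℝ) (Ω₀ Ω₁ : Set ℝ) (ε : ℝ) (f g : ℝ → ℝ) : Prop where
  continuousOn_left : ContinuousOn f Ω₀
  continuousOn_right : ContinuousOn g Ω₁
  isDualSolution : IsQOTDualSolution μ₀ μ₁ ε (fun x => x ^ 2 / 2 - f x) (fun y => y ^ 2 / 2 - g y)

/-- Admissible pairs of the (reparametrized) dual problem of optimal transport: integrable `f`, `g`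
with `f(x) + g(y) ≥ x y` on the product of the supports of the marginals. -/
structure IsKantorovichAdmissible (μ₀ μ₁ : Measure ℝ) (Ω₀ Ω₁ : Set ℝ) (f g : ℝ → ℝ) : Prop where
  integrable_left : Integrable f μ₀
  integrable_right : Integrable g μ₁
  mul_le : ∀ x ∈ Ω₀, ∀ y ∈ Ω₁, x * y ≤ f x + g y

/-- `(f, g)` are Kantorovich potentials of the unregularized problem: an admissible pair that
minimizes `∫ f dμ₀ + ∫ g dμ₁`, in the version that is continuous on the supports `Ω₀`, `Ω₁` of the
marginals (as finite convex potentials are). -/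
structure IsKantorovichPotential (μ₀ μ₁ : Measure ℝ) (Ω₀ Ω₁ : Set ℝ) (f g : ℝ → ℝ) : Prop where
  continuousOn_left : ContinuousOn f Ω₀
  continuousOn_right : ContinuousOn g Ω₁
  admissible : IsKantorovichAdmissible μ₀ μ₁ Ω₀ Ω₁ f g
  minimal : ∀ f' g' : ℝ → ℝ, IsKantorovichAdmissible μ₀ μ₁ Ω₀ Ω₁ f' g' →
    (∫ x, f x ∂μ₀) + (∫ y, g y ∂μ₁) ≤ (∫ x, f' x ∂μ₀) + (∫ y, g' y ∂μ₁)

/-- The Hölder norm `sup_Ω |h| + sup_{x ≠ y} |h(x) - h(y)| / |x - y|^α` on `Ω`, with values in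
`[0, ∞]`, so that it is infinite when `h` is not Hölder continuous. -/
noncomputable def holderNormOn (α : ℝ) (Ω : Set ℝ) (h : ℝ → ℝ) : ℝ≥0∞ :=
  (⨆ x ∈ Ω, ENNReal.ofReal |h x|)
    + ⨆ x ∈ Ω, ⨆ y ∈ Ω, ⨆ _ : x ≠ y, ENNReal.ofReal (|h x - h y| / |x - y| ^ α)

/-! Write `P = x y - f - g` for the regularized pair, `D = f₀ + g₀ - x y ≥ 0` for the slack of the
unregularized one, and `ε = η³`. Optimality says that `P₊` has mass `ε` on every section.
Integrating the identity `(f₀ - f) + (g₀ - g) = D + P` against `P₊` gives `ε K = A + B`, with `K`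
the duality gap, `A = ∬ D P₊` and `B = ∬ P₊²` (`mul_gap_eq`). Integrating it instead against a
coupling made of about `1/η` diagonal blocks gives `K ≤ M η² + B / (2ε)` (`gap_le_of_blocks`). Half
of `B` is absorbed, so `K` is of order `η²` and `A` of order `ε η²`.

The transport map `T` is bi-Lipschitz, so `D ≥ c (y - T x)²` (`le_slack`), and the bound on `A`
controls the second moments of `P₊` about the graph of `T`. The potential `g` is convex, hence
sections of `P` are concave, and the second moment bounds the radius of each section
(`sq_sub_mul_integral_posPart_le`): `{P(x, ·) > 0}` lies within `√(ω x)` of `T x`, with `∫ ω` of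
order `η²`.

A comparison of masses then bounds the slope of `f - f₀` by `√ω` (`sub_mul_sub_le_of_section`).
Integration and Cauchy–Schwarz yield an increment of order `η √(β - α)`, the Hölder seminorm bound.
The symmetric normalization turns the bound on `K` into one on the mean of `f - f₀`, and mean plus
oscillation bounds the supremum. -/

/-- The projection of the real line onto `[a, b]`. -/
def clampIcc (a b x : ℝ) : ℝ := max a (min b x)

theorem continuous_clampIcc (a b : ℝ) : Continuous (clampIcc a b) := by
  unfold clampIcc; fun_prop

theorem clampIcc_mem {a b : ℝ} (hab : a ≤ b) (x : ℝ) : clampIcc a b x ∈ Icc a b :=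
  ⟨le_max_left _ _, max_le hab (min_le_left _ _)⟩

theorem clampIcc_of_mem {a b x : ℝ} (hx : x ∈ Icc a b) : clampIcc a b x = x := by
  simp [clampIcc, hx.1, hx.2]

theorem continuous_comp_clampIcc {a b : ℝ} (hab : a ≤ b) {f : ℝ → ℝ}
    (hf : ContinuousOn f (Icc a b)) : Continuous (fun x => f (clampIcc a b x)) :=
  hf.comp_continuous (continuous_clampIcc a b) (clampIcc_mem hab)

/-! ### Marginals and their quantile functions -/

/-- `S` is the distribution function and `X` the quantile function of `μ`, both extended to
bi-Lipschitz bijections of the line. -/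
structure IsQuantilePair (μ : Measure ℝ) (a b l L : ℝ) (S X : ℝ → ℝ) : Prop where
  lower : ∀ x y, x ≤ y → l * (y - x) ≤ S y - S x
  upper : ∀ x y, x ≤ y → S y - S x ≤ L * (y - x)
  map_left : S a = 0
  map_right : S b = 1
  left_inv : ∀ x, X (S x) = x
  right_inv : ∀ s, S (X s) = s
  integral_eq : ∀ φ : ℝ → ℝ, Continuous φ → ∫ x, φ x ∂μ = ∫ s in (0 : ℝ)..1, φ (X s)

namespace IsRegularMarginal

variable {μ : Measure ℝ} {a b : ℝ} {u : ℝ → ℝ} {l L : ℝ}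

theorem lt (h : IsRegularMarginal μ a b u l L) : a < b := by
  by_contra hab
  have h0 : volume.restrict (Icc a b) = 0 := by
    rw [Measure.restrict_eq_zero, Real.volume_Icc]
    simpa using hab
  have h1 := h.isProbabilityMeasure
  rw [h.eq_withDensity, h0] at h1
  have := h1.measure_univ
  simp at this

theorem lower_le_upper (h : IsRegularMarginal μ a b u l L) : l ≤ L :=
  (h.lower_le a ⟨le_rfl, h.lt.le⟩).trans (h.le_upper a ⟨le_rfl, h.lt.le⟩)

theorem upper_pos (h : IsRegularMarginal μ a b u l L) : 0 < L :=
  h.lower_pos.trans_le h.lower_le_upper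

theorem absolutelyContinuous (h : IsRegularMarginal μ a b u l L) :
    μ ≪ volume.restrict (Icc a b) := by
  rw [h.eq_withDensity]
  exact withDensity_absolutelyContinuous _ _

theorem ae_mem (h : IsRegularMarginal μ a b u l L) : ∀ᵐ x ∂μ, x ∈ Icc a b :=
  h.absolutelyContinuous.ae_le (ae_restrict_mem measurableSet_Icc)

theorem restrict_eq (h : IsRegularMarginal μ a b u l L) : μ.restrict (Icc a b) = μ :=
  Measure.restrict_eq_self_of_ae_mem h.ae_mem

theorem integral_eq_intervalIntegral (h : IsRegularMarginal μ a b u l L) (φ : ℝ → ℝ) :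
    ∫ x, φ x ∂μ = ∫ x in a..b, u x * φ x := by
  have hm : AEMeasurable (fun x => ENNReal.ofReal (u x)) (volume.restrict (Icc a b)) :=
    (h.continuousOn_density.aemeasurable measurableSet_Icc).ennreal_ofReal
  rw [h.eq_withDensity, integral_withDensity_eq_integral_toReal_smul₀ hm (by simp),
    intervalIntegral.integral_of_le h.lt.le, ← integral_Icc_eq_integral_Ioc]
  refine setIntegral_congr_fun measurableSet_Icc fun x hx => ?_
  simp [ENNReal.toReal_ofReal (h.lower_pos.le.trans (h.lower_le x hx))]

theorem integrable_of_continuous (h : IsRegularMarginal μ a b u l L) {φ : ℝ → ℝ}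
    (hφ : Continuous φ) : Integrable φ μ := by
  have := h.isProbabilityMeasure
  rw [← h.restrict_eq]
  exact hφ.continuousOn.integrableOn_compact isCompact_Icc

theorem integral_congr_Icc (h : IsRegularMarginal μ a b u l L) {φ ψ : ℝ → ℝ}
    (hφ : ∀ x ∈ Icc a b, φ x = ψ x) : ∫ x, φ x ∂μ = ∫ x, ψ x ∂μ :=
  integral_congr_ae (h.ae_mem.mono fun x hx => hφ x hx)

theorem integral_mono_Icc (h : IsRegularMarginal μ a b u l L) {φ ψ : ℝ → ℝ}
    (hφ : Continuous φ) (hψ : Continuous ψ)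
    (hle : ∀ x ∈ Icc a b, φ x ≤ ψ x) : ∫ x, φ x ∂μ ≤ ∫ x, ψ x ∂μ :=
  integral_mono_ae (h.integrable_of_continuous hφ) (h.integrable_of_continuous hψ)
    (h.ae_mem.mono fun x hx => hle x hx)

theorem integral_const_eq (h : IsRegularMarginal μ a b u l L) (c : ℝ) : ∫ _, c ∂μ = c := by
  have := h.isProbabilityMeasure
  simp

theorem intervalIntegrable_density_mul (h : IsRegularMarginal μ a b u l L) {φ : ℝ → ℝ}
    (hφ : Continuous φ) : IntervalIntegrable (fun x => u x * φ x) volume a b := by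
  apply ContinuousOn.intervalIntegrable
  rw [uIcc_of_le h.lt.le]
  exact h.continuousOn_density.mul hφ.continuousOn

theorem lower_mul_intervalIntegral_le (h : IsRegularMarginal μ a b u l L) {φ : ℝ → ℝ}
    (hφ : Continuous φ) (h0 : ∀ x, 0 ≤ φ x) : l * ∫ x in a..b, φ x ≤ ∫ x, φ x ∂μ := by
  rw [h.integral_eq_intervalIntegral, ← intervalIntegral.integral_const_mul]
  refine intervalIntegral.integral_mono_on h.lt.le ((hφ.const_mul l).intervalIntegrable _ _)
    (h.intervalIntegrable_density_mul hφ) fun x hx => ?_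
  exact mul_le_mul_of_nonneg_right (h.lower_le x hx) (h0 x)

theorem integral_le_upper_mul (h : IsRegularMarginal μ a b u l L) {φ : ℝ → ℝ}
    (hφ : Continuous φ) (h0 : ∀ x, 0 ≤ φ x) : ∫ x, φ x ∂μ ≤ L * ∫ x in a..b, φ x := by
  rw [h.integral_eq_intervalIntegral, ← intervalIntegral.integral_const_mul]
  refine intervalIntegral.integral_mono_on h.lt.le (h.intervalIntegrable_density_mul hφ)
    ((hφ.const_mul L).intervalIntegrable _ _) fun x hx => ?_
  exact mul_le_mul_of_nonneg_right (h.le_upper x hx) (h0 x)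

/-- The lower density bound transfers the vanishing integral to Lebesgue measure, where continuity
upgrades almost everywhere to everywhere, endpoints included. -/
theorem eq_zero_of_integral_eq_zero (h : IsRegularMarginal μ a b u l L) {φ : ℝ → ℝ}
    (hφ : Continuous φ) (h0 : ∀ x ∈ Icc a b, 0 ≤ φ x) (hi : ∫ x, φ x ∂μ = 0) :
    ∀ x ∈ Icc a b, φ x = 0 := by
  have hpos : Continuous fun x => max (φ x) 0 := by fun_prop
  have h1 := h.lower_mul_intervalIntegral_le hpos fun x => le_max_right _ _
  rw [h.integral_congr_Icc (fun x hx => max_eq_left (h0 x hx)), hi] at h1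
  have h2 : ∫ x in a..b, max (φ x) 0 ≤ 0 := nonpos_of_mul_nonpos_right h1 h.lower_pos
  have h3 : 0 ≤ ∫ x in a..b, max (φ x) 0 :=
    intervalIntegral.integral_nonneg h.lt.le fun x _ => le_max_right _ _
  have h4 := (intervalIntegral.integral_eq_zero_iff_of_le_of_nonneg_ae h.lt.le
    (ae_of_all _ fun x => le_max_right (φ x) 0) (hpos.intervalIntegrable _ _)).1 (le_antisymm h2 h3)
  rw [Measure.restrict_congr_set Ioc_ae_eq_Icc] at h4
  have h5 := Measure.eqOn_Icc_of_ae_eq volume h.lt.ne h4 hpos.continuousOn continuousOn_const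
  intro x hx
  have := h5 hx
  simp only [Pi.zero_apply] at this
  rwa [max_eq_left (h0 x hx)] at this

theorem exists_isQuantilePair (h : IsRegularMarginal μ a b u l L) :
    ∃ S X : ℝ → ℝ, IsQuantilePair μ a b l L S X := by
  -- Extending the density by its endpoint values keeps it between `l` and `L` on the whole line, so
  -- `S` is a bijection of `ℝ` and its inverse needs no boundary cases.
  set v : ℝ → ℝ := fun x => u (clampIcc a b x) with hv
  have hvc : Continuous v := continuous_comp_clampIcc h.lt.le h.continuousOn_density
  have hvl : ∀ x, l ≤ v x := fun x => h.lower_le _ (clampIcc_mem h.lt.le x)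
  have hvL : ∀ x, v x ≤ L := fun x => h.le_upper _ (clampIcc_mem h.lt.le x)
  set S : ℝ → ℝ := fun x => ∫ r in a..x, v r with hS
  have hvi : ∀ x y, IntervalIntegrable v volume x y := fun x y => hvc.intervalIntegrable x y
  have hsub : ∀ x y, S y - S x = ∫ r in x..y, v r := fun x y =>
    intervalIntegral.integral_interval_sub_left (hvi _ _) (hvi _ _)
  have hlow : ∀ x y, x ≤ y → l * (y - x) ≤ S y - S x := by
    intro x y hxy
    rw [hsub]
    have := intervalIntegral.integral_mono_on hxy (intervalIntegrable_const (c := l)) (hvi x y)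
      fun r _ => hvl r
    simpa [mul_comm] using this
  have hupp : ∀ x y, x ≤ y → S y - S x ≤ L * (y - x) := by
    intro x y hxy
    rw [hsub]
    have := intervalIntegral.integral_mono_on hxy (hvi x y) (intervalIntegrable_const (c := L))
      fun r _ => hvL r
    simpa [mul_comm] using this
  have hder : ∀ x, HasDerivAt S (v x) x := fun x =>
    intervalIntegral.integral_hasDerivAt_right (hvi _ _)
      hvc.stronglyMeasurable.stronglyMeasurableAtFilter hvc.continuousAt
  have hSc : Continuous S := continuous_iff_continuousAt.2 fun x => (hder x).continuousAt
  have hmono : StrictMono S := fun x y hxy => by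
    have := hlow x y hxy.le
    have := mul_pos h.lower_pos (sub_pos.2 hxy)
    linarith
  have hsurj : Function.Surjective S := by
    refine hSc.surjective ?_ ?_
    · refine Filter.tendsto_atTop_mono' _ ?_
        ((Filter.tendsto_id.atTop_mul_const h.lower_pos).atTop_add
          (tendsto_const_nhds (x := S 0)))
      filter_upwards [Filter.eventually_ge_atTop 0] with x hx
      have := hlow 0 x hx
      simp only [id]
      linarith
    · refine Filter.tendsto_atBot_mono' _ ?_
        ((Filter.tendsto_id.atBot_mul_const h.lower_pos).atBot_add
          (tendsto_const_nhds (x := S 0)))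
      filter_upwards [Filter.eventually_le_atBot 0] with x hx
      have := hlow x 0 hx
      simp only [id]
      linarith
  have hri : ∀ s, S (Function.surjInv hsurj s) = s := Function.surjInv_eq hsurj
  have hli : ∀ x, Function.surjInv hsurj (S x) = x := fun x => hmono.injective (hri _)
  have hint : ∀ φ : ℝ → ℝ, ∫ x, φ x ∂μ = ∫ x in a..b, φ x * v x := by
    intro φ
    rw [h.integral_eq_intervalIntegral]
    refine intervalIntegral.integral_congr fun x hx => ?_
    rw [uIcc_of_le h.lt.le] at hx
    simp [hv, clampIcc_of_mem hx, mul_comm]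
  have ha : S a = 0 := by simp [hS]
  have hb : S b = 1 := by
    have h1 := hint fun _ => 1
    rw [h.integral_const_eq] at h1
    simp only [one_mul] at h1
    exact h1.symm
  refine ⟨S, Function.surjInv hsurj, hlow, hupp, ha, hb, hli, hri, fun φ hφ => ?_⟩
  have hXc : Continuous (Function.surjInv hsurj) := by
    have hX : Function.surjInv hsurj = (hmono.orderIsoOfSurjective S hsurj).symm := by
      funext s
      apply hmono.injective
      rw [hri]
      exact ((hmono.orderIsoOfSurjective S hsurj).apply_symm_apply s).symm
    rw [hX]
    exact OrderIso.continuous _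
  have := intervalIntegral.integral_comp_mul_deriv (a := a) (b := b) (f := S) (f' := v)
    (g := fun s => φ (Function.surjInv hsurj s)) (fun x _ => hder x) hvc.continuousOn
    (hφ.comp hXc)
  rw [ha, hb] at this
  rw [hint, ← this]
  simp [hli]

end IsRegularMarginal

namespace IsQuantilePair

variable {μ : Measure ℝ} {a b l L : ℝ} {S X : ℝ → ℝ}

theorem strictMono (h : IsQuantilePair μ a b l L S X) (hl : 0 < l) : StrictMono S := by
  intro x y hxy
  have := h.lower x y hxy.le
  have := mul_pos hl (sub_pos.2 hxy)
  linarith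

theorem monotone_quantile (h : IsQuantilePair μ a b l L S X) (hl : 0 < l) : Monotone X := by
  intro s t hst
  rw [← (h.strictMono hl).le_iff_le, h.right_inv, h.right_inv]
  exact hst

theorem quantile_lower (h : IsQuantilePair μ a b l L S X) (hl : 0 < l) {s t : ℝ} (hst : s ≤ t) :
    t - s ≤ L * (X t - X s) := by
  have := h.upper _ _ (h.monotone_quantile hl hst)
  rwa [h.right_inv, h.right_inv] at this

theorem quantile_upper (h : IsQuantilePair μ a b l L S X) (hl : 0 < l) {s t : ℝ} (hst : s ≤ t) :
    l * (X t - X s) ≤ t - s := by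
  have := h.lower _ _ (h.monotone_quantile hl hst)
  rwa [h.right_inv, h.right_inv] at this

theorem continuous (h : IsQuantilePair μ a b l L S X) (hl : 0 < l) : Continuous S := by
  have hsurj : Function.Surjective S := fun s => ⟨X s, h.right_inv s⟩
  exact (((h.strictMono hl).orderIsoOfSurjective S hsurj).continuous :)

theorem continuous_quantile (h : IsQuantilePair μ a b l L S X) (hl : 0 < l) : Continuous X :=
  (h.monotone_quantile hl).continuous_of_surjective fun x => ⟨S x, h.left_inv x⟩

theorem mem_Icc (h : IsQuantilePair μ a b l L S X) (hl : 0 < l) {x : ℝ} (hx : x ∈ Icc a b) :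
    S x ∈ Icc (0 : ℝ) 1 := by
  rw [← h.map_left, ← h.map_right]
  exact ⟨(h.strictMono hl).monotone hx.1, (h.strictMono hl).monotone hx.2⟩

theorem quantile_mem_Icc (h : IsQuantilePair μ a b l L S X) (hl : 0 < l) {s : ℝ}
    (hs : s ∈ Icc (0 : ℝ) 1) : X s ∈ Icc a b := by
  have h0 : X 0 = a := by rw [← h.map_left, h.left_inv]
  have h1 : X 1 = b := by rw [← h.map_right, h.left_inv]
  rw [← h0, ← h1]
  exact ⟨h.monotone_quantile hl hs.1, h.monotone_quantile hl hs.2⟩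

end IsQuantilePair

/-! ### First-order optimality conditions and convexity of the regularized potentials -/

/-- The second-order Taylor bound for `a ↦ a₊²`, whose derivative `2 a₊` is 2-Lipschitz. It replaces
differentiation of the dual objective. -/
theorem sq_posPart_add_le (a h : ℝ) :
    (max (a + h) 0) ^ 2 ≤ (max a 0) ^ 2 + 2 * (h * max a 0) + h ^ 2 := by
  have h0 : 0 ≤ max a 0 := le_max_right _ _
  have h1 : a ≤ max a 0 := le_max_left _ _
  rcases le_total (a + h) 0 with hc | hc
  · rw [max_eq_right hc]
    nlinarith [sq_nonneg (max a 0 + h)]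
  · rw [max_eq_left hc]
    nlinarith

/-- A linear term dominated by a quadratic one for both signs of `t` must vanish; this extracts the
first-order condition from maximality. -/
theorem eq_zero_of_mul_le_sq_mul {A B : ℝ} (h : ∀ t : ℝ, t * A ≤ t ^ 2 * B) : A = 0 := by
  by_contra hA
  have h1 := h (A / (|B| + 1))
  have hB : 0 < |B| + 1 := by positivity
  rw [div_mul_eq_mul_div, div_pow, div_mul_eq_mul_div, div_le_div_iff₀ hB (by positivity)] at h1
  have h2 : 0 < A * A := mul_self_pos.2 hA
  have h3 : B ≤ |B| := le_abs_self B
  have h4 : A ^ 2 * B ≤ A ^ 2 * |B| := mul_le_mul_of_nonneg_left h3 (sq_nonneg A)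
  have h5 : A * A * (|B| + 1) ^ 2 ≤ A * A * |B| * (|B| + 1) := by nlinarith
  have h6 : A * A * (|B| + 1) ≤ A * A * |B| := by
    by_contra hc
    push Not at hc
    nlinarith
  linarith

section Product

variable {μ₀ μ₁ : Measure ℝ} {a₀ b₀ a₁ b₁ : ℝ} {u₀ u₁ : ℝ → ℝ} {l L : ℝ}

theorem ae_mem_prod (h₀ : IsRegularMarginal μ₀ a₀ b₀ u₀ l L)
    (h₁ : IsRegularMarginal μ₁ a₁ b₁ u₁ l L) :
    ∀ᵐ z ∂(μ₀.prod μ₁), z ∈ Icc a₀ b₀ ×ˢ Icc a₁ b₁ := by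
  have := h₀.isProbabilityMeasure
  have := h₁.isProbabilityMeasure
  have e0 := Measure.quasiMeasurePreserving_fst (μ := μ₀) (ν := μ₁) |>.ae h₀.ae_mem
  have e1 := Measure.quasiMeasurePreserving_snd (μ := μ₀) (ν := μ₁) |>.ae h₁.ae_mem
  filter_upwards [e0, e1] with z hz0 hz1 using ⟨hz0, hz1⟩

theorem integrable_prod_of_continuous (h₀ : IsRegularMarginal μ₀ a₀ b₀ u₀ l L)
    (h₁ : IsRegularMarginal μ₁ a₁ b₁ u₁ l L) {φ : ℝ × ℝ → ℝ} (hφ : Continuous φ) :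
    Integrable φ (μ₀.prod μ₁) := by
  have := h₀.isProbabilityMeasure
  have := h₁.isProbabilityMeasure
  rw [← Measure.restrict_eq_self_of_ae_mem (ae_mem_prod h₀ h₁)]
  exact hφ.continuousOn.integrableOn_compact (isCompact_Icc.prod isCompact_Icc)

theorem continuous_integral_right (h₁ : IsRegularMarginal μ₁ a₁ b₁ u₁ l L) {φ : ℝ → ℝ → ℝ}
    (hφ : Continuous (Function.uncurry φ)) : Continuous fun x => ∫ y, φ x y ∂μ₁ := by
  have := h₁.isProbabilityMeasure
  have := continuous_parametric_integral_of_continuous (μ := μ₁) hφ (isCompact_Icc (a := a₁) (b := b₁))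
  rwa [h₁.restrict_eq] at this

theorem integral_prod_of_continuous (h₀ : IsRegularMarginal μ₀ a₀ b₀ u₀ l L)
    (h₁ : IsRegularMarginal μ₁ a₁ b₁ u₁ l L) {φ : ℝ → ℝ → ℝ}
    (hφ : Continuous (Function.uncurry φ)) :
    ∫ z : ℝ × ℝ, φ z.1 z.2 ∂(μ₀.prod μ₁) = ∫ x, ∫ y, φ x y ∂μ₁ ∂μ₀ := by
  have := h₀.isProbabilityMeasure
  have := h₁.isProbabilityMeasure
  exact integral_prod _ (integrable_prod_of_continuous h₀ h₁ hφ)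

theorem integral_swap_of_continuous (h₀ : IsRegularMarginal μ₀ a₀ b₀ u₀ l L)
    (h₁ : IsRegularMarginal μ₁ a₁ b₁ u₁ l L) {φ : ℝ → ℝ → ℝ}
    (hφ : Continuous (Function.uncurry φ)) :
    ∫ x, ∫ y, φ x y ∂μ₁ ∂μ₀ = ∫ y, ∫ x, φ x y ∂μ₀ ∂μ₁ := by
  have := h₀.isProbabilityMeasure
  have := h₁.isProbabilityMeasure
  exact integral_integral_swap (integrable_prod_of_continuous h₀ h₁ hφ)

theorem qotDualObjective_congr (h₀ : IsRegularMarginal μ₀ a₀ b₀ u₀ l L)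
    (h₁ : IsRegularMarginal μ₁ a₁ b₁ u₁ l L) {ε : ℝ} {f f' g g' : ℝ → ℝ}
    (hf : ∀ x ∈ Icc a₀ b₀, f x = f' x) (hg : ∀ y ∈ Icc a₁ b₁, g y = g' y) :
    qotDualObjective μ₀ μ₁ ε f g = qotDualObjective μ₀ μ₁ ε f' g' := by
  unfold qotDualObjective
  rw [h₀.integral_congr_Icc hf, h₁.integral_congr_Icc hg]
  congr 2
  refine integral_congr_ae ((ae_mem_prod h₀ h₁).mono fun z hz => ?_)
  simp only [hf _ hz.1, hg _ hz.2]

theorem qotDualObjective_swap [IsProbabilityMeasure μ₀] [IsProbabilityMeasure μ₁] {ε : ℝ}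
    (f g : ℝ → ℝ) : qotDualObjective μ₁ μ₀ ε g f = qotDualObjective μ₀ μ₁ ε f g := by
  unfold qotDualObjective
  rw [← integral_prod_swap (μ := μ₀) (ν := μ₁), add_comm (∫ x, g x ∂μ₁)]
  congr 2
  refine integral_congr_ae (ae_of_all _ fun z => ?_)
  simp only [Prod.fst_swap, Prod.snd_swap]
  rw [show g z.1 + f z.2 - (z.1 - z.2) ^ 2 / 2 = f z.2 + g z.1 - (z.2 - z.1) ^ 2 / 2 by ring]

theorem IsQOTPotential.swap (h₀ : IsRegularMarginal μ₀ a₀ b₀ u₀ l L)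
    (h₁ : IsRegularMarginal μ₁ a₁ b₁ u₁ l L) {ε : ℝ} {f g : ℝ → ℝ}
    (h : IsQOTPotential μ₀ μ₁ (Icc a₀ b₀) (Icc a₁ b₁) ε f g) :
    IsQOTPotential μ₁ μ₀ (Icc a₁ b₁) (Icc a₀ b₀) ε g f := by
  have := h₀.isProbabilityMeasure
  have := h₁.isProbabilityMeasure
  refine ⟨h.continuousOn_right, h.continuousOn_left, h.isDualSolution.memLp_right,
    h.isDualSolution.memLp_left, fun f' g' hf' hg' => ?_⟩
  rw [qotDualObjective_swap (μ₀ := μ₀) (μ₁ := μ₁), qotDualObjective_swap (μ₀ := μ₀) (μ₁ := μ₁)]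
  exact h.isDualSolution.maximal g' f' hg' hf'

theorem memLp_of_continuous (h₀ : IsRegularMarginal μ₀ a₀ b₀ u₀ l L) {φ : ℝ → ℝ}
    (hφ : Continuous φ) : MemLp φ 2 μ₀ :=
  (memLp_two_iff_integrable_sq hφ.aestronglyMeasurable).2
    (h₀.integrable_of_continuous (hφ.pow 2))

/-- The first marginal constraint for the density `(x y - f(x) - g(y))₊ / ε`. -/
theorem IsQOTPotential.integral_eq (h₀ : IsRegularMarginal μ₀ a₀ b₀ u₀ l L)
    (h₁ : IsRegularMarginal μ₁ a₁ b₁ u₁ l L) {ε : ℝ} (hε : 0 < ε) {f g : ℝ → ℝ}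
    (hf : Continuous f) (hg : Continuous g)
    (h : IsQOTPotential μ₀ μ₁ (Icc a₀ b₀) (Icc a₁ b₁) ε f g) :
    ∀ x ∈ Icc a₀ b₀, ∫ y, max (x * y - f x - g y) 0 ∂μ₁ = ε := by
  have := h₀.isProbabilityMeasure
  have := h₁.isProbabilityMeasure
  have hpc : Continuous (Function.uncurry fun x y => max (x * y - f x - g y) 0) := by
    unfold Function.uncurry; fun_prop
  set m : ℝ → ℝ := fun x => ∫ y, max (x * y - f x - g y) 0 ∂μ₁ with hm
  have hmc : Continuous m := continuous_integral_right h₁ hpc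
  -- The perturbation is the residual of the marginal constraint itself, so that the first variation
  -- is the square integral of the residual.
  set η : ℝ → ℝ := fun x => ε - m x with hη
  have hηc : Continuous η := by fun_prop
  have key : ∀ t : ℝ, t * (∫ x, η x * (ε - m x) ∂μ₀) ≤ t ^ 2 * ((∫ x, η x ^ 2 ∂μ₀) / 2) := by
    intro t
    have hmax := h.isDualSolution.maximal (fun x => x ^ 2 / 2 - f x + t * η x)
      (fun y => y ^ 2 / 2 - g y) (memLp_of_continuous h₀ (by fun_prop))
      (memLp_of_continuous h₁ (by fun_prop))
    unfold qotDualObjective at hmax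
    have e1 : ∫ x, x ^ 2 / 2 - f x + t * η x ∂μ₀
        = (∫ x, x ^ 2 / 2 - f x ∂μ₀) + t * ∫ x, η x ∂μ₀ := by
      rw [integral_add (h₀.integrable_of_continuous (by fun_prop))
        (h₀.integrable_of_continuous (by fun_prop)), integral_const_mul]
    have e2 : ∫ z : ℝ × ℝ, (max (z.1 ^ 2 / 2 - f z.1 + t * η z.1 + (z.2 ^ 2 / 2 - g z.2)
          - (z.1 - z.2) ^ 2 / 2) 0) ^ 2 ∂(μ₀.prod μ₁)
        ≤ (∫ z : ℝ × ℝ, (max (z.1 ^ 2 / 2 - f z.1 + (z.2 ^ 2 / 2 - g z.2)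
          - (z.1 - z.2) ^ 2 / 2) 0) ^ 2 ∂(μ₀.prod μ₁))
          + 2 * t * (∫ x, η x * m x ∂μ₀) + t ^ 2 * ∫ x, η x ^ 2 ∂μ₀ := by
      have i1 : ∫ x, η x * m x ∂μ₀
          = ∫ z : ℝ × ℝ, η z.1 * max (z.1 * z.2 - f z.1 - g z.2) 0 ∂(μ₀.prod μ₁) := by
        rw [integral_prod_of_continuous h₀ h₁ (φ := fun x y => η x * max (x * y - f x - g y) 0)
          (by unfold Function.uncurry; fun_prop)]
        simp only [integral_const_mul, hm]
      have i2 : ∫ x, η x ^ 2 ∂μ₀ = ∫ z : ℝ × ℝ, η z.1 ^ 2 ∂(μ₀.prod μ₁) := by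
        rw [integral_prod_of_continuous h₀ h₁ (φ := fun x y => η x ^ 2)
          (by unfold Function.uncurry; fun_prop)]
        simp
      rw [i1, i2, ← integral_const_mul, ← integral_const_mul, ← integral_add, ← integral_add]
      · refine integral_mono (integrable_prod_of_continuous h₀ h₁ (by fun_prop))
          (integrable_prod_of_continuous h₀ h₁ (by fun_prop)) fun z => ?_
        have := sq_posPart_add_le (z.1 * z.2 - f z.1 - g z.2) (t * η z.1)
        have r1 : z.1 ^ 2 / 2 - f z.1 + t * η z.1 + (z.2 ^ 2 / 2 - g z.2) - (z.1 - z.2) ^ 2 / 2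
          = z.1 * z.2 - f z.1 - g z.2 + t * η z.1 := by ring
        have r2 : z.1 ^ 2 / 2 - f z.1 + (z.2 ^ 2 / 2 - g z.2) - (z.1 - z.2) ^ 2 / 2
          = z.1 * z.2 - f z.1 - g z.2 := by ring
        simp only [r1, r2]
        refine this.trans (le_of_eq ?_)
        ring
      all_goals exact integrable_prod_of_continuous h₀ h₁ (by fun_prop)
    have e3 : ∫ x, η x * (ε - m x) ∂μ₀ = ε * (∫ x, η x ∂μ₀) - ∫ x, η x * m x ∂μ₀ := by
      rw [← integral_const_mul, ← integral_sub (h₀.integrable_of_continuous (by fun_prop))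
        (h₀.integrable_of_continuous (by fun_prop))]
      refine integral_congr_ae (ae_of_all _ fun x => ?_)
      simp only
      ring
    rw [e1] at hmax
    rw [e3]
    set J' := ∫ z : ℝ × ℝ, (max (z.1 ^ 2 / 2 - f z.1 + t * η z.1 + (z.2 ^ 2 / 2 - g z.2)
          - (z.1 - z.2) ^ 2 / 2) 0) ^ 2 ∂(μ₀.prod μ₁)
    set J := ∫ z : ℝ × ℝ, (max (z.1 ^ 2 / 2 - f z.1 + (z.2 ^ 2 / 2 - g z.2)
          - (z.1 - z.2) ^ 2 / 2) 0) ^ 2 ∂(μ₀.prod μ₁)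
    have h3 : t * (∫ x, η x ∂μ₀) ≤ 1 / (2 * ε) * (J' - J) := by linarith
    rw [div_mul_eq_mul_div, one_mul, le_div_iff₀ (by positivity)] at h3
    nlinarith
  have h4 := eq_zero_of_mul_le_sq_mul key
  have h5 := h₀.eq_zero_of_integral_eq_zero (φ := fun x => η x * (ε - m x)) (by fun_prop)
    (fun x _ => mul_self_nonneg _) h4
  intro x hx
  have := mul_self_eq_zero.1 (h5 x hx)
  linarith

/-- Clamping the potentials does not change the property. -/
theorem IsQOTPotential.clamp (h₀ : IsRegularMarginal μ₀ a₀ b₀ u₀ l L)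
    (h₁ : IsRegularMarginal μ₁ a₁ b₁ u₁ l L) {ε : ℝ} {f g : ℝ → ℝ}
    (h : IsQOTPotential μ₀ μ₁ (Icc a₀ b₀) (Icc a₁ b₁) ε f g) :
    IsQOTPotential μ₀ μ₁ (Icc a₀ b₀) (Icc a₁ b₁) ε
      (fun x => f (clampIcc a₀ b₀ x)) (fun y => g (clampIcc a₁ b₁ y)) := by
  have c0 := continuous_comp_clampIcc h₀.lt.le h.continuousOn_left
  have c1 := continuous_comp_clampIcc h₁.lt.le h.continuousOn_right
  refine ⟨c0.continuousOn, c1.continuousOn, 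
    memLp_of_continuous h₀ (((continuous_pow 2).div_const 2).sub c0),
    memLp_of_continuous h₁ (((continuous_pow 2).div_const 2).sub c1), fun f' g' hf' hg' => ?_⟩
  refine (h.isDualSolution.maximal f' g' hf' hg').trans (le_of_eq ?_)
  refine qotDualObjective_congr h₀ h₁ (fun x hx => ?_) (fun y hy => ?_)
  · rw [clampIcc_of_mem hx]
  · rw [clampIcc_of_mem hy]

/-- If two nonnegative functions have the same positive mass, one cannot exceed the other by a
fixed amount wherever the latter is positive. -/
theorem not_add_le_of_integral_posPart_eq (h₀ : IsRegularMarginal μ₀ a₀ b₀ u₀ l L)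
    {A B : ℝ → ℝ} (hA : Continuous A) (hB : Continuous B) (hA0 : ∀ x, 0 ≤ A x) {ε δ : ℝ}
    (hε : 0 < ε) (hδ : 0 < δ) (hAi : ∫ x, A x ∂μ₀ = ε) (hBi : ∫ x, max (B x) 0 ∂μ₀ = ε) :
    ¬ ∀ x ∈ Icc a₀ b₀, 0 < B x → B x + δ ≤ A x := by
  intro hle
  have hmc : Continuous fun x => max (B x) 0 := by fun_prop
  have hz := h₀.eq_zero_of_integral_eq_zero (φ := fun x => A x - max (B x) 0) (by fun_prop)
    (fun x hx => by
      rcases le_or_gt (B x) 0 with hb | hb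
      · simp only [max_eq_right hb, sub_zero]
        exact hA0 x
      · simp only [max_eq_left hb.le]
        linarith [hle x hx hb])
    (by rw [integral_sub (h₀.integrable_of_continuous hA) (h₀.integrable_of_continuous hmc), hAi,
      hBi, sub_self])
  have hB0 : ∀ x ∈ Icc a₀ b₀, max (B x) 0 = 0 := by
    intro x hx
    rcases le_or_gt (B x) 0 with hb | hb
    · exact max_eq_right hb
    · have h1 := hz x hx
      simp only [max_eq_left hb.le] at h1
      linarith [hle x hx hb]
  rw [h₀.integral_congr_Icc hB0, h₀.integral_const_eq] at hBi
  exact hε.ne hBi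

/-- If convexity failed, the average of the positive parts at `y` and `z` would exceed the
expression at the midpoint by a fixed amount wherever the latter is positive, although both have
mass `ε`. -/
theorem midpoint_convex_of_integral_posPart_eq (h₀ : IsRegularMarginal μ₀ a₀ b₀ u₀ l L)
    {f g : ℝ → ℝ} (hf : Continuous f) {ε : ℝ} (hε : 0 < ε)
    (hg : ∀ y ∈ Icc a₁ b₁, ∫ x, max (x * y - f x - g y) 0 ∂μ₀ = ε) {y z : ℝ}
    (hy : y ∈ Icc a₁ b₁) (hz : z ∈ Icc a₁ b₁) : g ((y + z) / 2) ≤ (g y + g z) / 2 := by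
  by_contra! hlt
  have hw : (y + z) / 2 ∈ Icc a₁ b₁ := ⟨by linarith [hy.1, hz.1], by linarith [hy.2, hz.2]⟩
  refine not_add_le_of_integral_posPart_eq h₀ (ε := ε)
    (A := fun x => (max (x * y - f x - g y) 0 + max (x * z - f x - g z) 0) / 2)
    (B := fun x => x * ((y + z) / 2) - f x - g ((y + z) / 2))
    (by fun_prop) (by fun_prop) (fun x => by positivity) hε (sub_pos.2 hlt) ?_ (hg _ hw) ?_
  · rw [integral_div, integral_add (h₀.integrable_of_continuous (by fun_prop))
      (h₀.integrable_of_continuous (by fun_prop)), hg y hy, hg z hz]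
    ring
  · intro x _ _
    have h1 := le_max_left (x * y - f x - g y) 0
    have h2 := le_max_left (x * z - f x - g z) 0
    linarith

end Product

/-! ### Monotone transport and unregularized potentials -/

/-- `T` is an increasing bi-Lipschitz bijection of the line with inverse `R` that maps `[a₀, b₀]`
onto `[a₁, b₁]` and pushes `μ₀` forward to `μ₁`. -/
structure IsMonotoneTransport (μ₀ μ₁ : Measure ℝ) (a₀ b₀ a₁ b₁ κ Λ : ℝ) (T R : ℝ → ℝ) : Prop where
  lower : ∀ x y, x ≤ y → κ * (y - x) ≤ T y - T x
  upper : ∀ x y, x ≤ y → T y - T x ≤ Λ * (y - x)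
  mapsTo : ∀ x ∈ Icc a₀ b₀, T x ∈ Icc a₁ b₁
  mapsTo_inv : ∀ y ∈ Icc a₁ b₁, R y ∈ Icc a₀ b₀
  left_inv : ∀ x, R (T x) = x
  right_inv : ∀ y, T (R y) = y
  integral_eq : ∀ φ : ℝ → ℝ, Continuous φ → ∫ y, φ y ∂μ₁ = ∫ x, φ (T x) ∂μ₀

theorem IsQuantilePair.isMonotoneTransport {μ₀ μ₁ : Measure ℝ} {a₀ b₀ a₁ b₁ l L : ℝ}
    {S₀ X₀ S₁ X₁ : ℝ → ℝ} (h₀ : IsQuantilePair μ₀ a₀ b₀ l L S₀ X₀)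
    (h₁ : IsQuantilePair μ₁ a₁ b₁ l L S₁ X₁) (hl : 0 < l) (hL : 0 < L) :
    IsMonotoneTransport μ₀ μ₁ a₀ b₀ a₁ b₁ (l / L) (L / l)
      (fun x => X₁ (S₀ x)) (fun y => X₀ (S₁ y)) where
  lower x y hxy := by
    have h1 := h₀.lower x y hxy
    have h2 := h₁.quantile_lower hl ((h₀.strictMono hl).monotone hxy)
    rw [div_mul_eq_mul_div, div_le_iff₀ hL]
    linarith
  upper x y hxy := by
    have h1 := h₀.upper x y hxy
    have h2 := h₁.quantile_upper hl ((h₀.strictMono hl).monotone hxy)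
    rw [div_mul_eq_mul_div, le_div_iff₀ hl]
    linarith
  mapsTo x hx := h₁.quantile_mem_Icc hl (h₀.mem_Icc hl hx)
  mapsTo_inv y hy := h₀.quantile_mem_Icc hl (h₁.mem_Icc hl hy)
  left_inv x := by simp only [h₁.right_inv, h₀.left_inv]
  right_inv y := by simp only [h₀.right_inv, h₁.left_inv]
  integral_eq φ hφ := by
    rw [h₁.integral_eq φ hφ, h₀.integral_eq (fun x => φ (X₁ (S₀ x)))
      (hφ.comp ((h₁.continuous_quantile hl).comp (h₀.continuous hl)))]
    simp only [h₀.right_inv]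

namespace IsMonotoneTransport

variable {μ₀ μ₁ : Measure ℝ} {a₀ b₀ a₁ b₁ κ Λ : ℝ} {T R : ℝ → ℝ}

theorem strictMono (h : IsMonotoneTransport μ₀ μ₁ a₀ b₀ a₁ b₁ κ Λ T R) (hκ : 0 < κ) :
    StrictMono T := by
  intro x y hxy
  have := h.lower x y hxy.le
  have := mul_pos hκ (sub_pos.2 hxy)
  linarith

theorem continuous (h : IsMonotoneTransport μ₀ μ₁ a₀ b₀ a₁ b₁ κ Λ T R) (hκ : 0 < κ) :
    Continuous T :=
  (h.strictMono hκ).monotone.continuous_of_surjective fun y => ⟨R y, h.right_inv y⟩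

theorem continuous_inv (h : IsMonotoneTransport μ₀ μ₁ a₀ b₀ a₁ b₁ κ Λ T R) (hκ : 0 < κ) :
    Continuous R := by
  have hm : Monotone R := fun y z hyz => by
    rw [← (h.strictMono hκ).le_iff_le, h.right_inv, h.right_inv]
    exact hyz
  exact hm.continuous_of_surjective fun x => ⟨T x, h.left_inv x⟩

theorem lower_sq (h : IsMonotoneTransport μ₀ μ₁ a₀ b₀ a₁ b₁ κ Λ T R) (x y : ℝ) :
    κ * (y - x) ^ 2 ≤ (y - x) * (T y - T x) := by
  rcases le_total x y with hxy | hxy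
  · nlinarith [h.lower x y hxy]
  · nlinarith [h.lower y x hxy]

theorem upper_sq (h : IsMonotoneTransport μ₀ μ₁ a₀ b₀ a₁ b₁ κ Λ T R) (x y : ℝ) :
    (y - x) * (T y - T x) ≤ Λ * (y - x) ^ 2 := by
  rcases le_total x y with hxy | hxy
  · nlinarith [h.upper x y hxy]
  · nlinarith [h.upper y x hxy]

theorem sq_sub_le (h : IsMonotoneTransport μ₀ μ₁ a₀ b₀ a₁ b₁ κ Λ T R) (hκ : 0 < κ) (x y : ℝ) :
    (T y - T x) ^ 2 ≤ Λ ^ 2 * (y - x) ^ 2 := by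
  rw [← mul_pow, sq_le_sq, abs_le]
  wlog hxy : x ≤ y generalizing x y
  · have := this y x (le_of_not_ge hxy)
    rw [show Λ * (y - x) = -(Λ * (x - y)) by ring, abs_neg]
    constructor <;> linarith [this.1, this.2]
  · have h1 := h.upper x y hxy
    have h2 := (h.strictMono hκ).monotone hxy
    have h3 := le_abs_self (Λ * (y - x))
    have h4 := abs_nonneg (Λ * (y - x))
    constructor <;> linarith

/-- There is a competitor for the Kantorovich problem with equality on the graph of `T`. -/
theorem exists_potential {u₀ u₁ : ℝ → ℝ} {l L : ℝ}
    (h : IsMonotoneTransport μ₀ μ₁ a₀ b₀ a₁ b₁ κ Λ T R) (hκ : 0 < κ)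
    (h₀ : IsRegularMarginal μ₀ a₀ b₀ u₀ l L) (h₁ : IsRegularMarginal μ₁ a₁ b₁ u₁ l L) :
    ∃ F G : ℝ → ℝ, Continuous F ∧ Continuous G ∧
      IsKantorovichAdmissible μ₀ μ₁ (Icc a₀ b₀) (Icc a₁ b₁) F G ∧
      ∀ x, F x + G (T x) = x * T x := by
  have hTc := h.continuous hκ
  have hRc := h.continuous_inv hκ
  have hTi : ∀ x y, IntervalIntegrable T volume x y := fun x y => hTc.intervalIntegrable x y
  -- `F` is convex with derivative `T`. Its partner below is the conjugate function, whose defining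
  -- supremum at `y` is attained at `R y`.
  set F : ℝ → ℝ := fun x => ∫ r in (0 : ℝ)..x, T r with hF
  have hFc : Continuous F := intervalIntegral.continuous_primitive hTi 0
  have hsub : ∀ x y, F y - F x = ∫ r in x..y, T r := fun x y =>
    intervalIntegral.integral_interval_sub_left (hTi _ _) (hTi _ _)
  have hge : ∀ x y, (y - x) * T x ≤ F y - F x := by
    intro x y
    rcases le_total x y with hxy | hxy
    · rw [hsub]
      have := intervalIntegral.integral_mono_on hxy (intervalIntegrable_const (c := T x)) (hTi x y)
        fun r hr => (h.strictMono hκ).monotone hr.1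
      simpa using this
    · have h1 := hsub y x
      have := intervalIntegral.integral_mono_on hxy (hTi y x) (intervalIntegrable_const (c := T x))
        fun r hr => (h.strictMono hκ).monotone hr.2
      simp only [intervalIntegral.integral_const, smul_eq_mul] at this
      linarith
  have hGc : Continuous fun y => R y * y - F (R y) := by fun_prop
  refine ⟨F, fun y => R y * y - F (R y), hFc, hGc,
    ⟨h₀.integrable_of_continuous hFc, h₁.integrable_of_continuous hGc, fun x _ y _ => ?_⟩,
    fun x => ?_⟩
  · have := hge (R y) x
    rw [h.right_inv] at this
    linarith
  · simp only [h.left_inv]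
    ring

end IsMonotoneTransport

section Kantorovich

variable {μ₀ μ₁ : Measure ℝ} {a₀ b₀ a₁ b₁ κ Λ : ℝ} {T R u₀ u₁ : ℝ → ℝ} {l L : ℝ}

theorem IsKantorovichPotential.clamp (h₀ : IsRegularMarginal μ₀ a₀ b₀ u₀ l L)
    (h₁ : IsRegularMarginal μ₁ a₁ b₁ u₁ l L) {f g : ℝ → ℝ}
    (h : IsKantorovichPotential μ₀ μ₁ (Icc a₀ b₀) (Icc a₁ b₁) f g) :
    IsKantorovichPotential μ₀ μ₁ (Icc a₀ b₀) (Icc a₁ b₁)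
      (fun x => f (clampIcc a₀ b₀ x)) (fun y => g (clampIcc a₁ b₁ y)) := by
  have c0 := continuous_comp_clampIcc h₀.lt.le h.continuousOn_left
  have c1 := continuous_comp_clampIcc h₁.lt.le h.continuousOn_right
  refine ⟨c0.continuousOn, c1.continuousOn, ⟨h₀.integrable_of_continuous c0,
    h₁.integrable_of_continuous c1, fun x hx y hy => ?_⟩, fun f' g' h' => ?_⟩
  · rw [clampIcc_of_mem hx, clampIcc_of_mem hy]
    exact h.admissible.mul_le x hx y hy
  · refine le_trans (le_of_eq ?_) (h.minimal f' g' h')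
    rw [h₀.integral_congr_Icc (ψ := f) fun x hx => by rw [clampIcc_of_mem hx],
      h₁.integral_congr_Icc (ψ := g) fun x hx => by rw [clampIcc_of_mem hx]]

/-- Equality holds along the graph of the monotone transport. -/
theorem IsKantorovichPotential.eq_of_transport
    (hT : IsMonotoneTransport μ₀ μ₁ a₀ b₀ a₁ b₁ κ Λ T R) (hκ : 0 < κ)
    (h₀ : IsRegularMarginal μ₀ a₀ b₀ u₀ l L) (h₁ : IsRegularMarginal μ₁ a₁ b₁ u₁ l L)
    {f g : ℝ → ℝ} (hf : Continuous f) (hg : Continuous g)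
    (h : IsKantorovichPotential μ₀ μ₁ (Icc a₀ b₀) (Icc a₁ b₁) f g) :
    ∀ x ∈ Icc a₀ b₀, f x + g (T x) = x * T x := by
  obtain ⟨F, G, hF, hG, hadm, heq⟩ := hT.exists_potential hκ h₀ h₁
  have hTc := hT.continuous hκ
  -- The competitor has value `∫ x T x dμ₀`, which bounds every admissible pair from below. Hence
  -- the nonnegative slack along the graph has zero integral.
  have hmin := h.minimal F G hadm
  rw [hT.integral_eq g hg, hT.integral_eq G hG,
    ← integral_add (h₀.integrable_of_continuous hf) (h₀.integrable_of_continuous (by fun_prop)),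
    ← integral_add (h₀.integrable_of_continuous hF)
      (h₀.integrable_of_continuous (by fun_prop))] at hmin
  simp only [heq] at hmin
  have hnn : ∀ x ∈ Icc a₀ b₀, 0 ≤ f x + g (T x) - x * T x := fun x hx =>
    sub_nonneg.2 (h.admissible.mul_le x hx _ (hT.mapsTo x hx))
  have hge := h₀.integral_mono_Icc (φ := fun x => x * T x) (ψ := fun x => f x + g (T x))
    (by fun_prop) (by fun_prop) fun x hx => sub_nonneg.1 (hnn x hx)
  have hz : ∫ x, (f x + g (T x) - x * T x) ∂μ₀ = 0 := by
    rw [integral_sub (h₀.integrable_of_continuous (by fun_prop))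
      (h₀.integrable_of_continuous (by fun_prop))]
    linarith
  intro x hx
  have := h₀.eq_zero_of_integral_eq_zero (by fun_prop) hnn hz x hx
  linarith

variable {f g : ℝ → ℝ}

/-- Since the slack vanishes on the graph, `T x` is a subgradient of `f` at `x`; the quadratic slack
bounds rest on this alone. -/
theorem subgradient_of_transport
    (hT : IsMonotoneTransport μ₀ μ₁ a₀ b₀ a₁ b₁ κ Λ T R)
    (hle : ∀ x ∈ Icc a₀ b₀, ∀ y ∈ Icc a₁ b₁, x * y ≤ f x + g y)
    (heq : ∀ x ∈ Icc a₀ b₀, f x + g (T x) = x * T x) {x z : ℝ}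
    (hx : x ∈ Icc a₀ b₀) (hz : z ∈ Icc a₀ b₀) : (z - x) * T x ≤ f z - f x := by
  have h1 := hle z hz (T x) (hT.mapsTo x hx)
  have h2 := heq x hx
  linarith

/-- Upper quadratic bound for the slack of a Kantorovich potential. -/
theorem slack_le
    (hT : IsMonotoneTransport μ₀ μ₁ a₀ b₀ a₁ b₁ κ Λ T R)
    (hle : ∀ x ∈ Icc a₀ b₀, ∀ y ∈ Icc a₁ b₁, x * y ≤ f x + g y)
    (heq : ∀ x ∈ Icc a₀ b₀, f x + g (T x) = x * T x) {x y : ℝ}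
    (hx : x ∈ Icc a₀ b₀) (hy : y ∈ Icc a₁ b₁) :
    f x + g y - x * y ≤ Λ * (x - R y) ^ 2 := by
  have hr := hT.mapsTo_inv y hy
  -- With `f (R y) + g y = R y * y`, this bounds the slack by `(R y - x) * (y - T x)`.
  have h1 := subgradient_of_transport hT hle heq hx hr
  have h2 := heq _ hr
  have h3 := hT.upper_sq (R y) x
  rw [hT.right_inv] at h2 h3
  nlinarith

/-- Lower quadratic bound for the slack of a Kantorovich potential. -/
theorem le_slack (hκ : 0 < κ)
    (hT : IsMonotoneTransport μ₀ μ₁ a₀ b₀ a₁ b₁ κ Λ T R)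
    (hle : ∀ x ∈ Icc a₀ b₀, ∀ y ∈ Icc a₁ b₁, x * y ≤ f x + g y)
    (heq : ∀ x ∈ Icc a₀ b₀, f x + g (T x) = x * T x) {x y : ℝ}
    (hx : x ∈ Icc a₀ b₀) (hy : y ∈ Icc a₁ b₁) :
    κ * (y - T x) ^ 2 ≤ 4 * Λ ^ 2 * (f x + g y - x * y) := by
  have hr := hT.mapsTo_inv y hy
  set r := R y with hrdef
  -- Splitting the segment from `r` to `x` at its midpoint and using the subgradient at the left end
  -- of each half, in the direction of travel, gives strong convexity with constant `κ / 4` and no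
  -- differentiation of `f`.
  have hm : (x + r) / 2 ∈ Icc a₀ b₀ := ⟨by linarith [hx.1, hr.1], by linarith [hx.2, hr.2]⟩
  have h1 := subgradient_of_transport hT hle heq hm hx
  have h2 := subgradient_of_transport hT hle heq hr hm
  have h3 := heq r hr
  have h4 := hT.lower_sq r ((x + r) / 2)
  have h5 := hT.sq_sub_le hκ x r
  have hTr : T r = y := hT.right_inv y
  rw [hTr] at h2 h3 h4 h5
  have h6 : κ * (x - r) ^ 2 ≤ 4 * (f x + g y - x * y) := by nlinarith
  calc κ * (y - T x) ^ 2 ≤ κ * (Λ ^ 2 * (r - x) ^ 2) := mul_le_mul_of_nonneg_left h5 hκ.le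
    _ = Λ ^ 2 * (κ * (x - r) ^ 2) := by ring
    _ ≤ Λ ^ 2 * (4 * (f x + g y - x * y)) := mul_le_mul_of_nonneg_left h6 (sq_nonneg _)
    _ = _ := by ring

end Kantorovich

/-! ### Auxiliary integral inequalities on the line -/

/-- Averaging over the diagonal blocks `[k / n, (k + 1) / n]²` of the unit square. -/
theorem integral_add_integral_le_of_diagonal {φ γ : ℝ → ℝ} (hφ : Continuous φ) (hγ : Continuous γ)
    {ρ : ℝ → ℝ → ℝ} (hρ : Continuous (Function.uncurry ρ)) (hρ0 : ∀ s t, 0 ≤ ρ s t)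
    {n : ℕ} (hn : 0 < n) {M : ℝ}
    (h : ∀ s ∈ Icc (0 : ℝ) 1, ∀ t ∈ Icc (0 : ℝ) 1, |s - t| ≤ 1 / n →
      n * (φ s + γ t) ≤ n * M + ρ s t) :
    (∫ s in (0 : ℝ)..1, φ s) + (∫ t in (0 : ℝ)..1, γ t)
      ≤ M + ∫ s in (0 : ℝ)..1, ∫ t in (0 : ℝ)..1, ρ s t := by
  have hn' : (0 : ℝ) < n := by exact_mod_cast hn
  set r : ℝ → ℝ := fun s => ∫ t in (0 : ℝ)..1, ρ s t with hr
  have hrc : Continuous r := intervalIntegral.continuous_parametric_intervalIntegral_of_continuous'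
    hρ 0 1
  have hρs : ∀ s, Continuous (ρ s) := fun s => hρ.comp (Continuous.prodMk_right s)
  have block : ∀ k : ℕ, k < n →
      (∫ s in (k / n : ℝ)..((k + 1 : ℕ) / n : ℝ), φ s)
        + (∫ t in (k / n : ℝ)..((k + 1 : ℕ) / n : ℝ), γ t)
      ≤ M / n + ∫ s in (k / n : ℝ)..((k + 1 : ℕ) / n : ℝ), r s := by
    intro k hk
    set α : ℝ := k / n with hα
    set β : ℝ := (k + 1 : ℕ) / n with hβ
    have hlen : β - α = 1 / n := by
      rw [hα, hβ, ← sub_div]; push_cast; ring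
    have hα0 : 0 ≤ α := by positivity
    have hβ1 : β ≤ 1 := by
      rw [hβ, div_le_one hn']
      exact_mod_cast hk
    have hαβ : α ≤ β := by
      have : (0 : ℝ) < 1 / n := by positivity
      linarith
    have inner : ∀ s ∈ Icc α β, φ s + n * (∫ t in α..β, γ t) ≤ M + r s := by
      intro s hs
      have h1 : ∫ t in α..β, n * (φ s + γ t) ≤ ∫ t in α..β, (n * M + ρ s t) := by
        refine intervalIntegral.integral_mono_on hαβ
          ((by fun_prop : Continuous _).intervalIntegrable _ _)
          ((continuous_const.add (hρs s)).intervalIntegrable _ _) fun t ht => ?_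
        refine h s ⟨hα0.trans hs.1, hs.2.trans hβ1⟩ t ⟨hα0.trans ht.1, ht.2.trans hβ1⟩ ?_
        rw [← hlen, abs_le]
        constructor <;> linarith [hs.1, hs.2, ht.1, ht.2]
      -- Nonnegativity of `ρ` allows the block section to be enlarged to the full section.
      have h2 : ∫ t in α..β, ρ s t ≤ r s :=
        intervalIntegral.integral_mono_interval hα0 hαβ hβ1 (ae_of_all _ fun t => hρ0 s t)
          ((hρs s).intervalIntegrable _ _)
      rw [intervalIntegral.integral_const_mul, intervalIntegral.integral_add
        (intervalIntegrable_const) (hγ.intervalIntegrable _ _), intervalIntegral.integral_add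
        (intervalIntegrable_const) ((hρs s).intervalIntegrable _ _),
        intervalIntegral.integral_const, intervalIntegral.integral_const, hlen, smul_eq_mul,
        smul_eq_mul, mul_add, ← mul_assoc, ← mul_assoc, mul_one_div_cancel hn'.ne',
        one_div_mul_cancel hn'.ne', one_mul, one_mul] at h1
      linarith
    have outer : ∫ s in α..β, (φ s + n * (∫ t in α..β, γ t)) ≤ ∫ s in α..β, (M + r s) :=
      intervalIntegral.integral_mono_on hαβ
        ((hφ.add continuous_const).intervalIntegrable _ _)
        ((continuous_const.add hrc).intervalIntegrable _ _) inner
    rw [intervalIntegral.integral_add (hφ.intervalIntegrable _ _) intervalIntegrable_const,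
      intervalIntegral.integral_add intervalIntegrable_const (hrc.intervalIntegrable _ _),
      intervalIntegral.integral_const, intervalIntegral.integral_const, hlen, smul_eq_mul,
      smul_eq_mul, ← mul_assoc, one_div_mul_cancel hn'.ne', one_mul, one_div_mul_eq_div] at outer
    exact outer
  have hsum : ∀ {f : ℝ → ℝ}, Continuous f →
      ∑ k ∈ Finset.range n, ∫ s in (k / n : ℝ)..((k + 1 : ℕ) / n : ℝ), f s
        = ∫ s in (0 : ℝ)..1, f s := by
    intro f hf
    have := intervalIntegral.sum_integral_adjacent_intervals (μ := volume) (f := f)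
      (a := fun k : ℕ => (k / n : ℝ)) (n := n) fun k _ => hf.intervalIntegrable _ _
    rw [this]
    simp [hn'.ne']
  have := Finset.sum_le_sum fun k (hk : k ∈ Finset.range n) => block k (Finset.mem_range.1 hk)
  rw [Finset.sum_add_distrib, Finset.sum_add_distrib, hsum hφ, hsum hγ, hsum hrc, Finset.sum_const,
    Finset.card_range, nsmul_eq_mul, mul_div_cancel₀ _ hn'.ne'] at this
  exact this

/-- The second moment of the positive part of a concave function about any point controls the
distance of that point to every point of the positivity set. -/
theorem sq_sub_mul_integral_posPart_le {a b τ y₀ : ℝ} (hab : a ≤ b) {P : ℝ → ℝ}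
    (hP : Continuous P)
    (hconc : ∀ y ∈ Icc a b, ∀ z ∈ Icc a b, (P y + P z) / 2 ≤ P ((y + z) / 2))
    (hy₀ : y₀ ∈ Icc a b) (hPy₀ : 0 ≤ P y₀) :
    (y₀ - τ) ^ 2 * (∫ y in a..b, max (P y) 0) ≤ 34 * ∫ y in a..b, (y - τ) ^ 2 * max (P y) 0 := by
  set w : ℝ → ℝ := fun y => (y - τ) ^ 2 * max (P y) 0 with hw
  have hwc : Continuous w := by fun_prop
  have hw0 : ∀ y, 0 ≤ w y := fun y => by positivity
  -- Contract halfway towards `y₀`: the image stays in `[a, b]` and the change of variables costs a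
  -- factor 2. By concavity `P` at least halves, giving the factor 8 in `h2`. The final constant is
  -- `34 = 2 + 2 * (8 * 2)`.
  have h1 : ∫ y in a..b, w (y / 2 + y₀ / 2) ≤ 2 * ∫ y in a..b, w y := by
    rw [intervalIntegral.integral_comp_div_add _ two_ne_zero, smul_eq_mul]
    refine mul_le_mul_of_nonneg_left ?_ two_pos.le
    exact intervalIntegral.integral_mono_interval (by linarith [hy₀.1]) (by linarith)
      (by linarith [hy₀.2]) (ae_of_all _ hw0) (hwc.intervalIntegrable _ _)
  have h2 : ∫ y in a..b, (y - τ + (y₀ - τ)) ^ 2 * max (P y) 0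
      ≤ ∫ y in a..b, 8 * w (y / 2 + y₀ / 2) := by
    refine intervalIntegral.integral_mono_on hab
      ((by fun_prop : Continuous _).intervalIntegrable _ _)
      ((by fun_prop : Continuous _).intervalIntegrable _ _) fun y hy => ?_
    have h3 : max (P y) 0 ≤ 2 * max (P (y / 2 + y₀ / 2)) 0 := by
      have := hconc y hy y₀ hy₀
      rw [← add_div]
      have h4 := le_max_left (P ((y + y₀) / 2)) 0
      have h5 := le_max_right (P ((y + y₀) / 2)) 0
      exact max_le (by linarith) (by linarith)
    calc (y - τ + (y₀ - τ)) ^ 2 * max (P y) 0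
        ≤ (y - τ + (y₀ - τ)) ^ 2 * (2 * max (P (y / 2 + y₀ / 2)) 0) :=
          mul_le_mul_of_nonneg_left h3 (sq_nonneg _)
      _ = 8 * w (y / 2 + y₀ / 2) := by
          simp only [hw]
          ring
  rw [intervalIntegral.integral_const_mul] at h2
  have h6 : ∫ y in a..b, (y₀ - τ) ^ 2 * max (P y) 0
      ≤ ∫ y in a..b, (2 * w y + 2 * ((y - τ + (y₀ - τ)) ^ 2 * max (P y) 0)) := by
    refine intervalIntegral.integral_mono_on hab
      ((by fun_prop : Continuous _).intervalIntegrable _ _)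
      ((by fun_prop : Continuous _).intervalIntegrable _ _) fun y _ => ?_
    have h7 : (y₀ - τ) ^ 2 ≤ 2 * (y - τ) ^ 2 + 2 * (y - τ + (y₀ - τ)) ^ 2 := by
      nlinarith [sq_nonneg (2 * (y - τ) + (y₀ - τ))]
    have := mul_le_mul_of_nonneg_right h7 (le_max_right (P y) 0)
    simp only [hw]
    linarith
  rw [intervalIntegral.integral_const_mul, intervalIntegral.integral_add
    ((by fun_prop : Continuous _).intervalIntegrable _ _)
    ((by fun_prop : Continuous _).intervalIntegrable _ _), intervalIntegral.integral_const_mul,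
    intervalIntegral.integral_const_mul] at h6
  linarith

/-- A function whose difference quotients are asymptotically bounded by a continuous function `W`
grows at most like the primitive of `W`. -/
theorem sub_le_integral_of_sub_le {k W : ℝ → ℝ} {α β Λ : ℝ} (hαβ : α ≤ β) (hk : Continuous k)
    (hW : Continuous W)
    (h : ∀ x ∈ Icc α β, ∀ z ∈ Icc α β, x < z →
      k z - k x ≤ (z - x) * (max (W x) (W z) + Λ * (z - x))) :
    k β - k α ≤ ∫ x in α..β, W x := by
  have hder : ∀ x, HasDerivAt (fun x => k α + ∫ r in α..x, W r) (W x) x := fun x =>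
    (intervalIntegral.integral_hasDerivAt_right (hW.intervalIntegrable _ _)
      hW.stronglyMeasurable.stronglyMeasurableAtFilter hW.continuousAt).const_add _
  -- Only right difference quotients have to be controlled, so `k` need not be differentiable.
  have := image_le_of_liminf_slope_right_le_deriv_boundary (f := k) (a := α) (b := β)
    (B := fun x => k α + ∫ r in α..x, W r) (B' := W) hk.continuousOn (by simp)
    (fun x _ => (hder x).continuousAt.continuousWithinAt)
    (fun x _ => (hder x).hasDerivWithinAt) (fun x hx r hr => ?_) (right_mem_Icc.2 hαβ)
  · linarith
  · have hc : Continuous fun z => max (W x) (W z) + Λ * (z - x) := by fun_prop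
    have h1 : ∀ᶠ z in nhds x, max (W x) (W z) + Λ * (z - x) < r :=
      hc.continuousAt.eventually_lt_const (by simpa using hr)
    have h2 : ∀ᶠ z in nhdsWithin x (Ioi x), z ∈ Ioc x β := Ioc_mem_nhdsGT hx.2
    refine ((h1.filter_mono nhdsWithin_le_nhds).and h2).frequently.mono fun z hz => ?_
    have h3 := h x ⟨hx.1, hx.2.le⟩ z ⟨hx.1.trans hz.2.1.le, hz.2.2⟩ hz.2.1
    have h4 : 0 < z - x := sub_pos.2 hz.2.1
    rw [slope_def_field, div_lt_iff₀ h4]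
    calc k z - k x ≤ (z - x) * (max (W x) (W z) + Λ * (z - x)) := h3
      _ < (z - x) * r := mul_lt_mul_of_pos_left hz.1 h4
      _ = r * (z - x) := mul_comm _ _

/-! ### Duality gap and width of the support sections -/

section Estimates

variable {μ₀ μ₁ : Measure ℝ} {a₀ b₀ a₁ b₁ κ Λ : ℝ} {T R u₀ u₁ : ℝ → ℝ} {l L : ℝ}
  {f g f₀ g₀ : ℝ → ℝ} {ε : ℝ}

/-- The duality gap splits into the Kantorovich slack and the regularization energy. -/
theorem mul_gap_eq (h₀ : IsRegularMarginal μ₀ a₀ b₀ u₀ l L)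
    (h₁ : IsRegularMarginal μ₁ a₁ b₁ u₁ l L)
    (hf : Continuous f) (hg : Continuous g) (hf₀ : Continuous f₀) (hg₀ : Continuous g₀)
    (hx : ∀ x ∈ Icc a₀ b₀, ∫ y, max (x * y - f x - g y) 0 ∂μ₁ = ε)
    (hy : ∀ y ∈ Icc a₁ b₁, ∫ x, max (x * y - f x - g y) 0 ∂μ₀ = ε) :
    ε * ((∫ x, (f₀ x - f x) ∂μ₀) + ∫ y, (g₀ y - g y) ∂μ₁)
      = (∫ x, ∫ y, (f₀ x + g₀ y - x * y) * max (x * y - f x - g y) 0 ∂μ₁ ∂μ₀)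
        + ∫ x, ∫ y, (max (x * y - f x - g y) 0) ^ 2 ∂μ₁ ∂μ₀ := by
  -- The marginal constraints turn `ε` times each single integral into a double integral against the
  -- density.
  have e1 : ∫ x, ∫ y, (f₀ x - f x) * max (x * y - f x - g y) 0 ∂μ₁ ∂μ₀
      = ε * ∫ x, (f₀ x - f x) ∂μ₀ := by
    rw [← integral_const_mul]
    refine h₀.integral_congr_Icc fun x hx' => ?_
    rw [integral_const_mul, hx x hx', mul_comm]
  have e2 : ∫ x, ∫ y, (g₀ y - g y) * max (x * y - f x - g y) 0 ∂μ₁ ∂μ₀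
      = ε * ∫ y, (g₀ y - g y) ∂μ₁ := by
    rw [integral_swap_of_continuous h₀ h₁ (φ := fun x y => (g₀ y - g y) * max (x * y - f x - g y) 0)
      (by unfold Function.uncurry; fun_prop), ← integral_const_mul]
    refine h₁.integral_congr_Icc fun y hy' => ?_
    rw [integral_const_mul, hy y hy', mul_comm]
  rw [mul_add, ← e1, ← e2]
  rw [← integral_prod_of_continuous h₀ h₁ (φ := fun x y => (f₀ x - f x) * max (x * y - f x - g y) 0)
      (by unfold Function.uncurry; fun_prop),
    ← integral_prod_of_continuous h₀ h₁ (φ := fun x y => (g₀ y - g y) * max (x * y - f x - g y) 0)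
      (by unfold Function.uncurry; fun_prop),
    ← integral_prod_of_continuous h₀ h₁
      (φ := fun x y => (f₀ x + g₀ y - x * y) * max (x * y - f x - g y) 0)
      (by unfold Function.uncurry; fun_prop),
    ← integral_prod_of_continuous h₀ h₁ (φ := fun x y => (max (x * y - f x - g y) 0) ^ 2)
      (by unfold Function.uncurry; fun_prop),
    ← integral_add (integrable_prod_of_continuous h₀ h₁ (by fun_prop))
      (integrable_prod_of_continuous h₀ h₁ (by fun_prop)),
    ← integral_add (integrable_prod_of_continuous h₀ h₁ (by fun_prop))
      (integrable_prod_of_continuous h₀ h₁ (by fun_prop))]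
  refine integral_congr_ae (ae_of_all _ fun z => ?_)
  simp only
  rcases le_total (z.1 * z.2 - f z.1 - g z.2) 0 with hc | hc
  · simp [max_eq_right hc]
  · rw [max_eq_left hc]
    ring

/-- Comparison of the duality gap with a block coupling with `n` blocks. -/
theorem gap_le_of_blocks {S₀ X₀ S₁ X₁ : ℝ → ℝ}
    (h₁ : IsRegularMarginal μ₁ a₁ b₁ u₁ l L)
    (q₀ : IsQuantilePair μ₀ a₀ b₀ l L S₀ X₀) (q₁ : IsQuantilePair μ₁ a₁ b₁ l L S₁ X₁)
    (hl : 0 < l) (hΛ : 0 ≤ Λ) (hε : 0 < ε)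
    (hf : Continuous f) (hg : Continuous g) (hf₀ : Continuous f₀) (hg₀ : Continuous g₀)
    (hD : ∀ x ∈ Icc a₀ b₀, ∀ y ∈ Icc a₁ b₁,
      f₀ x + g₀ y - x * y ≤ Λ * (x - X₀ (S₁ y)) ^ 2)
    {n : ℕ} (hn : 0 < n) :
    (∫ x, (f₀ x - f x) ∂μ₀) + (∫ y, (g₀ y - g y) ∂μ₁)
      ≤ Λ / l ^ 2 * (1 / n) ^ 2 + ε * n / 2
        + (∫ x, ∫ y, (max (x * y - f x - g y) 0) ^ 2 ∂μ₁ ∂μ₀) / (2 * ε) := by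
  have hn' : (0 : ℝ) < n := by exact_mod_cast hn
  have hX₀ := q₀.continuous_quantile hl
  have hX₁ := q₁.continuous_quantile hl
  have hB : (∫ x, ∫ y, (max (x * y - f x - g y) 0) ^ 2 ∂μ₁ ∂μ₀) / (2 * ε)
      = ∫ s in (0 : ℝ)..1, ∫ t in (0 : ℝ)..1,
        (max (X₀ s * X₁ t - f (X₀ s) - g (X₁ t)) 0) ^ 2 / (2 * ε) := by
    rw [q₀.integral_eq _ (continuous_integral_right h₁
      (φ := fun x y => (max (x * y - f x - g y) 0) ^ 2) (by unfold Function.uncurry; fun_prop)),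
      ← intervalIntegral.integral_div]
    refine intervalIntegral.integral_congr fun s _ => ?_
    rw [q₁.integral_eq _ (by fun_prop), ← intervalIntegral.integral_div]
  rw [hB, q₀.integral_eq (fun x => f₀ x - f x) (by fun_prop),
    q₁.integral_eq (fun y => g₀ y - g y) (by fun_prop)]
  refine integral_add_integral_le_of_diagonal (by fun_prop) (by fun_prop)
    (ρ := fun s t => (max (X₀ s * X₁ t - f (X₀ s) - g (X₁ t)) 0) ^ 2 / (2 * ε))
    (by unfold Function.uncurry; fun_prop) (fun s t => by positivity) hn fun s hs t ht hst => ?_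
  have h1 := hD _ (q₀.quantile_mem_Icc hl hs) _ (q₁.quantile_mem_Icc hl ht)
  rw [q₁.right_inv] at h1
  have h2 : l * |X₀ s - X₀ t| ≤ 1 / n := by
    refine le_trans ?_ hst
    rcases le_total s t with hc | hc
    · rw [abs_sub_comm (X₀ s), abs_sub_comm s, abs_of_nonneg (sub_nonneg.2 hc),
        abs_of_nonneg (sub_nonneg.2 (q₀.monotone_quantile hl hc))]
      exact q₀.quantile_upper hl hc
    · rw [abs_of_nonneg (sub_nonneg.2 hc),
        abs_of_nonneg (sub_nonneg.2 (q₀.monotone_quantile hl hc))]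
      exact q₀.quantile_upper hl hc
  have h3 : (X₀ s - X₀ t) ^ 2 ≤ (1 / n) ^ 2 / l ^ 2 := by
    rw [le_div_iff₀ (by positivity), ← sq_abs, ← mul_pow, mul_comm]
    exact pow_le_pow_left₀ (by positivity) h2 2
  have h4 : Λ * (X₀ s - X₀ t) ^ 2 ≤ Λ / l ^ 2 * (1 / n) ^ 2 :=
    (mul_le_mul_of_nonneg_left h3 hΛ).trans (le_of_eq (by ring))
  set P := X₀ s * X₁ t - f (X₀ s) - g (X₁ t) with hP
  have h5 : n * P ≤ n * (ε * n / 2) + (max P 0) ^ 2 / (2 * ε) := by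
    have h6 : P ≤ max P 0 := le_max_left _ _
    -- Young's inequality with weight `ε`: the block coupling has density `n`, and its quadratic
    -- cost is the term `ε n / 2`.
    have h7 : n * P ≤ n * max P 0 := mul_le_mul_of_nonneg_left h6 hn'.le
    have h8 : n * (ε * n / 2) + (max P 0) ^ 2 / (2 * ε) - n * max P 0
        = (max P 0 - ε * n) ^ 2 / (2 * ε) := by
      field_simp
      ring
    have h9 : 0 ≤ (max P 0 - ε * n) ^ 2 / (2 * ε) := by positivity
    linarith
  have h10 : f₀ (X₀ s) - f (X₀ s) + (g₀ (X₁ t) - g (X₁ t))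
      = (f₀ (X₀ s) + g₀ (X₁ t) - X₀ s * X₁ t) + P := by rw [hP]; ring
  rw [h10, mul_add, mul_add]
  have h11 := mul_le_mul_of_nonneg_left (h1.trans h4) hn'.le
  linarith

/-- The choice `n = ⌈1 / η⌉` balances the transport error `1 / n²` against the regularization cost
`ε n` at `ε = η³`; this is the origin of the exponent `1/3`. -/
theorem exists_nat_block_count {η : ℝ} (hη : 0 < η) (hη1 : η ≤ 1) :
    ∃ n : ℕ, 0 < n ∧ (1 / (n : ℝ)) ^ 2 ≤ η ^ 2 ∧ η ^ 3 * n / 2 ≤ η ^ 2 := by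
  refine ⟨⌈1 / η⌉₊, Nat.ceil_pos.2 (by positivity), ?_, ?_⟩
  · have h1 : 1 / η ≤ (⌈1 / η⌉₊ : ℝ) := Nat.le_ceil _
    refine pow_le_pow_left₀ (by positivity) ?_ 2
    rw [div_le_iff₀ ((by positivity : 0 < 1 / η).trans_le h1)]
    rw [div_le_iff₀ hη] at h1
    linarith
  · have h2 : (⌈1 / η⌉₊ : ℝ) < 1 / η + 1 := Nat.ceil_lt_add_one (by positivity)
    have h3 : η * (1 / η + 1) = 1 + η := by field_simp
    have h4 : η * (⌈1 / η⌉₊ : ℝ) ≤ 2 := by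
      have := mul_le_mul_of_nonneg_left h2.le hη.le
      linarith
    have h5 := mul_le_mul_of_nonneg_left h4 (sq_nonneg η)
    nlinarith

/-- The conditional second moment, suitably scaled, bounds the sections of the support. -/
theorem sq_sub_le_of_pos (h₁ : IsRegularMarginal μ₁ a₁ b₁ u₁ l L) (hε : 0 < ε)
    {P : ℝ → ℝ} (hP : Continuous P)
    (hconc : ∀ y ∈ Icc a₁ b₁, ∀ z ∈ Icc a₁ b₁, (P y + P z) / 2 ≤ P ((y + z) / 2))
    (hPi : ∫ y, max (P y) 0 ∂μ₁ = ε) {τ y : ℝ} (hy : y ∈ Icc a₁ b₁) (hPy : 0 < P y) :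
    (y - τ) ^ 2 ≤ 34 * L / (l * ε) * ∫ z, (z - τ) ^ 2 * max (P z) 0 ∂μ₁ := by
  have hl := h₁.lower_pos
  have hL := h₁.upper_pos
  have t1 := sq_sub_mul_integral_posPart_le (τ := τ) h₁.lt.le hP hconc hy hPy.le
  have t2 := h₁.integral_le_upper_mul (φ := fun y => max (P y) 0) (by fun_prop)
    fun y => le_max_right _ _
  have t3 := h₁.lower_mul_intervalIntegral_le (φ := fun z => (z - τ) ^ 2 * max (P z) 0)
    (by fun_prop) fun y => by positivity
  rw [hPi] at t2
  have t4 := mul_le_mul_of_nonneg_left t2 (mul_nonneg hl.le (sq_nonneg (y - τ)))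
  have t5 := mul_le_mul_of_nonneg_left t1 (mul_nonneg hl.le hL.le)
  have t6 := mul_le_mul_of_nonneg_left t3 (mul_nonneg (by norm_num : (0 : ℝ) ≤ 34) hL.le)
  rw [div_mul_eq_mul_div, le_div_iff₀ (by positivity)]
  linarith

/-- One-sided difference bound for the regularized potential. -/
theorem sub_mul_sub_le_of_section (h₁ : IsRegularMarginal μ₁ a₁ b₁ u₁ l L) (hε : 0 < ε)
    (hg : Continuous g) {x z τ w : ℝ}
    (hx : ∫ y, max (x * y - f x - g y) 0 ∂μ₁ = ε) (hz : ∫ y, max (z * y - f z - g y) 0 ∂μ₁ = ε)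
    (hw : ∀ y ∈ Icc a₁ b₁, 0 < x * y - f x - g y → |y - τ| ≤ w) :
    (z - x) * τ - |z - x| * w ≤ f z - f x := by
  -- Otherwise the section at `z` would exceed the section at `x` by a fixed amount on the
  -- positivity set of the latter, against equality of masses.
  by_contra! hlt
  refine not_add_le_of_integral_posPart_eq h₁ (A := fun y => max (z * y - f z - g y) 0)
    (B := fun y => x * y - f x - g y) (by fun_prop) (by fun_prop) (fun y => le_max_right _ _) hε
    (sub_pos.2 hlt) hz hx fun y hy hpos => ?_
  have h1 := hw y hy hpos
  have h2 : -((z - x) * (y - τ)) ≤ |z - x| * w := by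
    calc -((z - x) * (y - τ)) ≤ |(z - x) * (y - τ)| := neg_le_abs _
      _ = |z - x| * |y - τ| := abs_mul _ _
      _ ≤ |z - x| * w := mul_le_mul_of_nonneg_left h1 (abs_nonneg _)
  have h3 := le_max_left (z * y - f z - g y) 0
  linarith

/-- Cauchy–Schwarz, obtained from the pointwise Young inequality with the optimal weight `θ = √(β -
α) / Q`. -/
theorem integral_sqrt_le {ω : ℝ → ℝ} (hω : Continuous ω) (hω0 : ∀ x, 0 ≤ ω x) {α β Q : ℝ}
    (hαβ : α < β) (hQ : 0 < Q) (hi : ∫ x in α..β, ω x ≤ Q ^ 2) :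
    ∫ x in α..β, √(ω x) ≤ Q * √(β - α) := by
  have hd : 0 < √(β - α) := Real.sqrt_pos.2 (sub_pos.2 hαβ)
  have hd2 : √(β - α) ^ 2 = β - α := Real.sq_sqrt (sub_pos.2 hαβ).le
  set d := √(β - α) with hddef
  set θ := d / Q with hθ
  have hθ0 : 0 < θ := by positivity
  have h1 : ∫ x in α..β, √(ω x) ≤ ∫ x in α..β, (θ / 2 * ω x + 1 / (2 * θ)) := by
    refine intervalIntegral.integral_mono_on hαβ.le
      ((by fun_prop : Continuous _).intervalIntegrable _ _)
      ((by fun_prop : Continuous _).intervalIntegrable _ _) fun x _ => ?_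
    have h2 : θ / 2 * ω x + 1 / (2 * θ) - √(ω x) = (θ * √(ω x) - 1) ^ 2 / (2 * θ) := by
      conv_lhs => rw [← Real.sq_sqrt (hω0 x), Real.sqrt_sq (Real.sqrt_nonneg _)]
      field_simp
      ring
    have h3 : 0 ≤ (θ * √(ω x) - 1) ^ 2 / (2 * θ) := by positivity
    linarith
  rw [intervalIntegral.integral_add ((by fun_prop : Continuous _).intervalIntegrable _ _)
    intervalIntegrable_const, intervalIntegral.integral_const_mul,
    intervalIntegral.integral_const, smul_eq_mul, ← hd2] at h1
  have h4 := mul_le_mul_of_nonneg_left hi (by positivity : 0 ≤ θ / 2)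
  have h5 : θ / 2 * Q ^ 2 + d ^ 2 * (1 / (2 * θ)) = Q * d := by
    rw [hθ]
    field_simp
    ring
  linarith

end Estimates

/-! ### Quantitative estimate and conclusion -/

section Main

variable {μ₀ μ₁ : Measure ℝ} {a₀ b₀ a₁ b₁ : ℝ} {u₀ u₁ : ℝ → ℝ} {l L : ℝ}

/-- Quantitative convergence of continuous potentials at `ε = η³`: a bound of order `η²` for the
duality gap and a Hölder bound of order `η` for the difference of the first potentials. -/
theorem exists_gap_and_holder_bound (h₀ : IsRegularMarginal μ₀ a₀ b₀ u₀ l L)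
    (h₁ : IsRegularMarginal μ₁ a₁ b₁ u₁ l L) :
    ∃ M Q : ℝ, 0 < M ∧ 0 < Q ∧ ∀ η : ℝ, 0 < η → η ≤ 1 → ∀ f g f₀ g₀ : ℝ → ℝ,
      Continuous f → Continuous g → Continuous f₀ → Continuous g₀ →
      IsQOTPotential μ₀ μ₁ (Icc a₀ b₀) (Icc a₁ b₁) (η ^ 3) f g →
      IsKantorovichPotential μ₀ μ₁ (Icc a₀ b₀) (Icc a₁ b₁) f₀ g₀ →
      |(∫ x, (f₀ x - f x) ∂μ₀) + ∫ y, (g₀ y - g y) ∂μ₁| ≤ M * η ^ 2 ∧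
      ∀ α ∈ Icc a₀ b₀, ∀ β ∈ Icc a₀ b₀, α < β →
        |(f β - f₀ β) - (f α - f₀ α)| ≤ Q * η * √(β - α) := by
  have hl := h₀.lower_pos
  have hL := h₀.upper_pos
  obtain ⟨S₀, X₀, q₀⟩ := h₀.exists_isQuantilePair
  obtain ⟨S₁, X₁, q₁⟩ := h₁.exists_isQuantilePair
  have hT := q₀.isMonotoneTransport q₁ hl hL
  set T : ℝ → ℝ := fun x => X₁ (S₀ x) with hTdef
  set κ : ℝ := l / L with hκdef
  set Λ : ℝ := L / l with hΛdef
  have hκ : 0 < κ := div_pos hl hL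
  have hΛ : 0 < Λ := div_pos hL hl
  have hTc : Continuous T := hT.continuous hκ
  set M : ℝ := Λ / l ^ 2 + 1 with hMdef
  have hM : 0 < M := by positivity
  -- The product of `34 L / l` from the section bound, `4 Λ² / κ` from the slack bound, `M` from the
  -- gap, and `1 / l` for passing from `μ₀` to Lebesgue measure.
  set N : ℝ := 136 * L * Λ ^ 2 / (l ^ 2 * κ) * M with hNdef
  have hN : 0 < N := by positivity
  refine ⟨2 * M, √N, by positivity, Real.sqrt_pos.2 hN, ?_⟩
  intro η hη hη1 f g f₀ g₀ hf hg hf₀ hg₀ hq hk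
  set ε : ℝ := η ^ 3 with hεdef
  have hε : 0 < ε := by positivity
  have hx := hq.integral_eq h₀ h₁ hε hf hg
  have hy : ∀ y ∈ Icc a₁ b₁, ∫ x, max (x * y - f x - g y) 0 ∂μ₀ = ε := by
    intro y hy
    rw [← (hq.swap h₀ h₁).integral_eq h₁ h₀ hε hg hf y hy]
    refine integral_congr_ae (ae_of_all _ fun x => ?_)
    simp only
    congr 1
    ring
  have hle := hk.admissible.mul_le
  have heq := hk.eq_of_transport hT hκ h₀ h₁ hf₀ hg₀
  set A : ℝ := ∫ x, ∫ y, (f₀ x + g₀ y - x * y) * max (x * y - f x - g y) 0 ∂μ₁ ∂μ₀ with hA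
  set B : ℝ := ∫ x, ∫ y, (max (x * y - f x - g y) 0) ^ 2 ∂μ₁ ∂μ₀ with hB
  set K : ℝ := (∫ x, (f₀ x - f x) ∂μ₀) + ∫ y, (g₀ y - g y) ∂μ₁ with hK
  have hgap : ε * K = A + B := mul_gap_eq h₀ h₁ hf hg hf₀ hg₀ hx hy
  have hA0 : 0 ≤ A := by
    refine integral_nonneg_of_ae (h₀.ae_mem.mono fun x hx' => ?_)
    refine integral_nonneg_of_ae (h₁.ae_mem.mono fun y hy' => ?_)
    exact mul_nonneg (sub_nonneg.2 (hle x hx' y hy')) (le_max_right _ _)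
  have hB0 : 0 ≤ B := integral_nonneg fun x => integral_nonneg fun y => sq_nonneg _
  have hKM : K ≤ M * η ^ 2 + B / (2 * ε) := by
    obtain ⟨n, hn, hn1, hn2⟩ := exists_nat_block_count hη hη1
    have h1 := gap_le_of_blocks h₁ q₀ q₁ hl hΛ.le hε hf hg hf₀ hg₀
      (fun x hx' y hy' => slack_le hT hle heq hx' hy') hn
    have h2 := mul_le_mul_of_nonneg_left hn1 (by positivity : 0 ≤ Λ / l ^ 2)
    rw [hMdef, add_mul, one_mul]
    linarith
  have hK0 : 0 ≤ K := nonneg_of_mul_nonneg_right (hgap ▸ add_nonneg hA0 hB0) hε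
  -- Inserting `ε K = A + B` into `hKM` leaves half of `B` on the left.
  have hAB : A + B / 2 ≤ ε * (M * η ^ 2) := by
    have h1 := mul_le_mul_of_nonneg_left hKM hε.le
    have h2 : ε * (B / (2 * ε)) = B / 2 := by field_simp
    rw [hgap, mul_add, h2] at h1
    linarith
  refine ⟨?_, ?_⟩
  · rw [abs_of_nonneg hK0]
    have : ε * K ≤ ε * (2 * M * η ^ 2) := by rw [hgap]; linarith
    exact le_of_mul_le_mul_left this hε
  set ω : ℝ → ℝ := fun x =>
    34 * L / (l * ε) * ∫ y, (y - T x) ^ 2 * max (x * y - f x - g y) 0 ∂μ₁ with hω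
  have hωc : Continuous ω := continuous_const.mul (continuous_integral_right h₁
    (φ := fun x y => (y - T x) ^ 2 * max (x * y - f x - g y) 0)
    (by unfold Function.uncurry; fun_prop))
  have hω0 : ∀ x, 0 ≤ ω x := fun x =>
    mul_nonneg (by positivity) (integral_nonneg fun y => by positivity)
  have hωi : ∫ x in a₀..b₀, ω x ≤ N * η ^ 2 := by
    have h1 := h₀.lower_mul_intervalIntegral_le hωc hω0
    have h2 : κ * (∫ x, ∫ y, (y - T x) ^ 2 * max (x * y - f x - g y) 0 ∂μ₁ ∂μ₀)
        ≤ 4 * Λ ^ 2 * A := by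
      rw [hA, ← integral_const_mul, ← integral_const_mul]
      simp only [← integral_const_mul]
      refine h₀.integral_mono_Icc
        (continuous_integral_right h₁
          (φ := fun x y => κ * ((y - T x) ^ 2 * max (x * y - f x - g y) 0))
          (by unfold Function.uncurry; fun_prop))
        (continuous_integral_right h₁
          (φ := fun x y => 4 * Λ ^ 2 * ((f₀ x + g₀ y - x * y) * max (x * y - f x - g y) 0))
          (by unfold Function.uncurry; fun_prop)) fun x hx' => ?_
      refine h₁.integral_mono_Icc (by fun_prop) (by fun_prop) fun y hy' => ?_
      have := mul_le_mul_of_nonneg_right (le_slack hκ hT hle heq hx' hy')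
        (le_max_right (x * y - f x - g y) 0)
      linarith
    have h3 : ∫ x, ω x ∂μ₀ = 34 * L / (l * ε)
        * ∫ x, ∫ y, (y - T x) ^ 2 * max (x * y - f x - g y) 0 ∂μ₁ ∂μ₀ := integral_const_mul _ _
    have h4 : A ≤ ε * (M * η ^ 2) := by linarith
    set V := ∫ x, ∫ y, (y - T x) ^ 2 * max (x * y - f x - g y) 0 ∂μ₁ ∂μ₀ with hV
    have h5 : V ≤ 4 * Λ ^ 2 * (ε * (M * η ^ 2)) / κ := by
      rw [le_div_iff₀ hκ]
      have := mul_le_mul_of_nonneg_left h4 (by positivity : 0 ≤ 4 * Λ ^ 2)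
      linarith
    have h6 : l * (∫ x in a₀..b₀, ω x) ≤ l * (N * η ^ 2) := by
      refine h1.trans ?_
      rw [h3]
      refine (mul_le_mul_of_nonneg_left h5 (by positivity)).trans (le_of_eq ?_)
      rw [hNdef]
      field_simp
      ring
    exact le_of_mul_le_mul_left h6 hl
  have hsec : ∀ x ∈ Icc a₀ b₀, ∀ y ∈ Icc a₁ b₁, 0 < x * y - f x - g y → |y - T x| ≤ √(ω x) := by
    intro x hx' y hy' hpos
    refine Real.le_sqrt_of_sq_le ?_
    rw [sq_abs]
    refine sq_sub_le_of_pos h₁ hε (P := fun y => x * y - f x - g y) (by fun_prop)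
      (fun y hy₁ z hz₁ => ?_) (hx x hx') hy' hpos
    have := midpoint_convex_of_integral_posPart_eq h₀ hf hε hy hy₁ hz₁
    linarith
  -- The section at `x` bounds the increment of `f` from below, the subgradient of `f₀` at `z`
  -- bounds that of `f₀` from above; `T z - T x` accounts for the quadratic error.
  have hstep : ∀ x ∈ Icc a₀ b₀, ∀ z ∈ Icc a₀ b₀,
      (f x - f₀ x) - (f z - f₀ z) ≤ |z - x| * √(ω x) + Λ * (z - x) ^ 2 := by
    intro x hx' z hz'
    have h1 := sub_mul_sub_le_of_section h₁ hε hg (hx x hx') (hx z hz') (hsec x hx')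
    have h2 := subgradient_of_transport hT hle heq hz' hx'
    have h3 := hT.upper_sq x z
    linarith
  intro α hα β hβ hαβ
  have hsub : ∀ x ∈ Icc α β, x ∈ Icc a₀ b₀ := fun x hx' => ⟨hα.1.trans hx'.1, hx'.2.trans hβ.2⟩
  have hint : ∫ x in α..β, √(ω x) ≤ √N * η * √(β - α) := by
    refine integral_sqrt_le hωc hω0 hαβ (mul_pos (Real.sqrt_pos.2 hN) hη) ?_
    rw [mul_pow, Real.sq_sqrt hN.le]
    exact (intervalIntegral.integral_mono_interval hα.1 hαβ.le hβ.2 (ae_of_all _ hω0)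
      (hωc.intervalIntegrable _ _)).trans hωi
  have hup : (f β - f₀ β) - (f α - f₀ α) ≤ ∫ x in α..β, √(ω x) := by
    refine sub_le_integral_of_sub_le (k := fun x => f x - f₀ x) (Λ := Λ) hαβ.le (by fun_prop)
      (by fun_prop) fun x hx' z hz' hxz => ?_
    -- The one-sided bound is based at the right endpoint here and at the left one in `hlow`; the
    -- maximum of `W x` and `W z` in `sub_le_integral_of_sub_le` covers both.
    have h1 := hstep z (hsub z hz') x (hsub x hx')
    have h2 := mul_le_mul_of_nonneg_left (le_max_right (√(ω x)) (√(ω z))) (sub_pos.2 hxz).le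
    rw [abs_sub_comm, abs_of_pos (sub_pos.2 hxz)] at h1
    linarith
  have hlow : (f₀ β - f β) - (f₀ α - f α) ≤ ∫ x in α..β, √(ω x) := by
    refine sub_le_integral_of_sub_le (k := fun x => f₀ x - f x) (Λ := Λ) hαβ.le (by fun_prop)
      (by fun_prop) fun x hx' z hz' hxz => ?_
    have h1 := hstep x (hsub x hx') z (hsub z hz')
    have h2 := mul_le_mul_of_nonneg_left (le_max_left (√(ω x)) (√(ω z))) (sub_pos.2 hxz).le
    rw [abs_of_pos (sub_pos.2 hxz)] at h1
    linarith
  rw [abs_le]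
  constructor <;> linarith

end Main

theorem holderNormOn_le {Ω : Set ℝ} {h : ℝ → ℝ} {A B : ℝ} (hA0 : 0 ≤ A) (hB0 : 0 ≤ B)
    (hA : ∀ x ∈ Ω, |h x| ≤ A) (hB : ∀ x ∈ Ω, ∀ y ∈ Ω, x < y → |h y - h x| ≤ B * √(y - x)) :
    holderNormOn (1 / 2) Ω h ≤ ENNReal.ofReal (A + B) := by
  rw [ENNReal.ofReal_add hA0 hB0]
  refine add_le_add (iSup₂_le fun x hx => ENNReal.ofReal_le_ofReal (hA x hx))
    (iSup₂_le fun x hx => iSup₂_le fun y hy => iSup_le fun hxy => ENNReal.ofReal_le_ofReal ?_)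
  rw [← Real.sqrt_eq_rpow, div_le_iff₀ (Real.sqrt_pos.2 (abs_pos.2 (sub_ne_zero.2 hxy)))]
  rcases lt_or_gt_of_ne hxy with hlt | hlt
  · rw [abs_sub_comm, abs_sub_comm x, abs_of_pos (sub_pos.2 hlt)]
    exact hB x hx y hy hlt
  · rw [abs_of_pos (sub_pos.2 hlt)]
    exact hB y hy x hx hlt

theorem corollary2p4
    (μ₀ μ₁ : Measure ℝ) (a₀ b₀ a₁ b₁ : ℝ) (u₀ u₁ : ℝ → ℝ) (l L : ℝ)
    (hμ₀ : IsRegularMarginal μ₀ a₀ b₀ u₀ l L)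
    (hμ₁ : IsRegularMarginal μ₁ a₁ b₁ u₁ l L) :
    ∃ C ε₀ : ℝ, 0 < C ∧ 0 < ε₀ ∧
      ∀ ε : ℝ, 0 < ε → ε < ε₀ →
        ∀ fε gε f₀ g₀ : ℝ → ℝ,
          IsQOTPotential μ₀ μ₁ (Icc a₀ b₀) (Icc a₁ b₁) ε fε gε →
          IsKantorovichPotential μ₀ μ₁ (Icc a₀ b₀) (Icc a₁ b₁) f₀ g₀ →
          (∫ x, fε x ∂μ₀) = (∫ y, gε y ∂μ₁) →
          (∫ x, f₀ x ∂μ₀) = (∫ y, g₀ y ∂μ₁) →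
          holderNormOn (1 / 2) (Icc a₀ b₀) (fun x => fε x - f₀ x)
            ≤ ENNReal.ofReal (C * ε ^ ((1 : ℝ) / 3)) := by
  obtain ⟨M, Q, hM, hQ, hest⟩ := exists_gap_and_holder_bound hμ₀ hμ₁
  refine ⟨M + Q * √(b₀ - a₀) + Q, 1, by positivity, one_pos, ?_⟩
  intro ε hε hε1 fε gε f₀ g₀ hq hk hnε hn₀
  set η : ℝ := ε ^ ((1 : ℝ) / 3) with hη
  have hη0 : 0 < η := Real.rpow_pos_of_pos hε _
  have hη1 : η ≤ 1 := Real.rpow_le_one hε.le hε1.le (by norm_num)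
  have hη3 : η ^ 3 = ε := by
    rw [hη, ← Real.rpow_natCast, ← Real.rpow_mul hε.le]
    norm_num
  rw [← hη3] at hq
  -- The potentials are continuous only on the supports; clamping extends them continuously to the
  -- line without changing any integral or optimality property.
  have c0 := continuous_comp_clampIcc hμ₀.lt.le hq.continuousOn_left
  have c1 := continuous_comp_clampIcc hμ₁.lt.le hq.continuousOn_right
  have c2 := continuous_comp_clampIcc hμ₀.lt.le hk.continuousOn_left
  have c3 := continuous_comp_clampIcc hμ₁.lt.le hk.continuousOn_right
  obtain ⟨hgap, hosc⟩ := hest η hη0 hη1 _ _ _ _ c0 c1 c2 c3 (hq.clamp hμ₀ hμ₁) (hk.clamp hμ₀ hμ₁)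
  have i0 : ∫ x, fε (clampIcc a₀ b₀ x) ∂μ₀ = ∫ x, fε x ∂μ₀ :=
    hμ₀.integral_congr_Icc fun x hx => by rw [clampIcc_of_mem hx]
  have i1 : ∫ x, gε (clampIcc a₁ b₁ x) ∂μ₁ = ∫ x, gε x ∂μ₁ :=
    hμ₁.integral_congr_Icc fun x hx => by rw [clampIcc_of_mem hx]
  have i2 : ∫ x, f₀ (clampIcc a₀ b₀ x) ∂μ₀ = ∫ x, f₀ x ∂μ₀ :=
    hμ₀.integral_congr_Icc fun x hx => by rw [clampIcc_of_mem hx]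
  have i3 : ∫ x, g₀ (clampIcc a₁ b₁ x) ∂μ₁ = ∫ x, g₀ x ∂μ₁ :=
    hμ₁.integral_congr_Icc fun x hx => by rw [clampIcc_of_mem hx]
  rw [integral_sub (hμ₀.integrable_of_continuous c2) (hμ₀.integrable_of_continuous c0),
    integral_sub (hμ₁.integrable_of_continuous c3) (hμ₁.integrable_of_continuous c1),
    i0, i1, i2, i3, ← hnε, ← hn₀] at hgap
  set h : ℝ → ℝ := fun x => fε (clampIcc a₀ b₀ x) - f₀ (clampIcc a₀ b₀ x) with hh
  have hc : Continuous h := c0.sub c2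
  -- Under the symmetric normalization the gap is twice the difference of the means of `f₀` and
  -- `fε`.
  have hmean : |∫ x, h x ∂μ₀| ≤ M * η := by
    have h1 : ∫ x, h x ∂μ₀ = (∫ x, fε x ∂μ₀) - ∫ x, f₀ x ∂μ₀ := by
      rw [hh, integral_sub (hμ₀.integrable_of_continuous c0) (hμ₀.integrable_of_continuous c2),
        i0, i2]
    have h2 : M * η ^ 2 ≤ M * η := mul_le_mul_of_nonneg_left (by nlinarith) hM.le
    have h3 : 0 ≤ M * η := by positivity
    rw [h1, abs_le]
    rw [abs_le] at hgap
    constructor <;> linarith [hgap.1, hgap.2]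
  have hosc' : ∀ x ∈ Icc a₀ b₀, ∀ y ∈ Icc a₀ b₀, |h y - h x| ≤ Q * √(b₀ - a₀) * η := by
    intro x hx y hy
    have h1 : ∀ x ∈ Icc a₀ b₀, ∀ y ∈ Icc a₀ b₀, x < y → |h y - h x| ≤ Q * √(b₀ - a₀) * η := by
      intro x hx y hy hxy
      refine (hosc x hx y hy hxy).trans ?_
      have : √(y - x) ≤ √(b₀ - a₀) := Real.sqrt_le_sqrt (by linarith [hx.1, hy.2])
      have := mul_le_mul_of_nonneg_left this (mul_pos hQ hη0).le
      linarith
    rcases lt_trichotomy x y with hxy | hxy | hxy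
    · exact h1 x hx y hy hxy
    · rw [hxy, sub_self, abs_zero]
      positivity
    · rw [abs_sub_comm]
      exact h1 y hy x hx hxy
  have hsup : ∀ x ∈ Icc a₀ b₀, |h x| ≤ (M + Q * √(b₀ - a₀)) * η := by
    intro x hx
    have h1 := hμ₀.integral_mono_Icc (φ := h) (ψ := fun _ => h x + Q * √(b₀ - a₀) * η) hc
      continuous_const fun y hy => by linarith [(abs_le.1 (hosc' x hx y hy)).2]
    have h2 := hμ₀.integral_mono_Icc (φ := fun _ => h x - Q * √(b₀ - a₀) * η) (ψ := h)
      continuous_const hc fun y hy => by linarith [(abs_le.1 (hosc' x hx y hy)).1]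
    rw [hμ₀.integral_const_eq] at h1 h2
    rw [abs_le] at hmean ⊢
    constructor <;> linarith [hmean.1, hmean.2]
  have heq : ∀ x ∈ Icc a₀ b₀, fε x - f₀ x = h x := fun x hx => by
    simp only [hh, clampIcc_of_mem hx]
  have hfin := holderNormOn_le (Ω := Icc a₀ b₀) (h := fun x => fε x - f₀ x)
    (A := (M + Q * √(b₀ - a₀)) * η) (B := Q * η) (by positivity) (by positivity)
    (fun x hx => by rw [heq x hx]; exact hsup x hx)
    (fun x hx y hy hxy => by rw [heq x hx, heq y hy]; exact hosc x hx y hy hxy)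
  rwa [← add_mul] at hfin
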